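/- A hypergraph $\mathcal H$ on a finite set $X$ is a non-empty set of subsets of $X$ (its edges). It is $r$-bounded if $|e|\le r$ for every $e\in\mathcal H$, and, for a real $\kappa>0$, it is $\kappa$-spread if $$|\{e\in\mathcal H: S\subseteq e\}|\le \frac{|\mathcal H|}{\kappa^{|S|}}\qquad\text{for all } S\subseteq X.$$ Let each element of $X$ receive an independent uniformly random colour from $[q]$ and, independently, let $X_m$ be a uniformly random $m$-subset of $X$. A set is rainbow if its elements have pairwise distinct colours. There is an absolute constant $C>0$ such that the following holds for every constant $C_1>0$. Consider a sequence, indexed by $n\in\mathbb N$, of finite sets $X$, $r$-bounded and $\kappa$-spread hypergraphs $\mathcal H$ on $X$, and integers $q\ge r$ and $0\le m\le |X|$ (where $X,\mathcal H,r,\kappa,q,m$ all depend on $n$). Suppose that for all $n$ (i) $r\le |X|/2$, (ii) $r\le C_1\kappa$, and $m\ge \dfrac{(C\log r)\,|X|}{\kappa}$, and that, as $n\to\infty$, $r\to\infty$ and (iii) $(\log|X|)/\kappa\to 0$. Then $$\Pr\big(X_m\text{ contains a rainbow edge of }\mathcal H\big)\to 1\qquad (n\to\infty).$$ -/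

import Mathlib

open Filter Topology

namespace RainbowThreshold

variable {X : Type*}

/-- A hypergraph on `X`, given as its finite set of edges, is `r`-bounded if every edge has at
most `r` elements. -/
def IsBounded (H : Finset (Finset X)) (r : ℕ) : Prop :=
  ∀ e ∈ H, e.card ≤ r

open Classical in
/-- `H` is `κ`-spread: for every `S ⊆ X`, the number of edges that contain `S` is at most
`|H| / κ ^ |S|`. -/
def IsSpread (H : Finset (Finset X)) (κ : ℝ) : Prop :=
  ∀ S : Finset X, ((H.filter (fun e => S ⊆ e)).card : ℝ) ≤ (H.card : ℝ) / κ ^ S.card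

/-- A set is rainbow under the colouring `c` if no two of its elements have the same colour. -/
def IsRainbow {q : ℕ} (c : X → Fin q) (e : Finset X) : Prop :=
  ∀ x ∈ e, ∀ y ∈ e, x ≠ y → c x ≠ c y

/-- `W` contains an edge of `H` that is rainbow under the colouring `c`. -/
def ContainsRainbowEdge {q : ℕ} (H : Finset (Finset X)) (W : Finset X) (c : X → Fin q) : Prop :=
  ∃ e ∈ H, e ⊆ W ∧ IsRainbow c e

open Classical in
/-- The sample space: all pairs of an `m`-subset of `X` and a colouring of `X` with `q` colours. -/
noncomputable def sampleSpace (X : Type*) [Fintype X] (q m : ℕ) :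
    Finset (Finset X × (X → Fin q)) :=
  Finset.powersetCard m Finset.univ ×ˢ Finset.univ

open Classical in
/-- The probability that `X_m` contains a rainbow edge of `H`, where `X_m` is a uniformly random
`m`-subset of `X` and, independently, every element of `X` gets an independent uniformly random
colour from `q` colours; that is, the pair is uniform on `sampleSpace X q m`. -/
noncomputable def rainbowProb [Fintype X] (H : Finset (Finset X)) (q m : ℕ) : ℝ :=
  (((sampleSpace X q m).filter (fun ω => ContainsRainbowEdge H ω.1 ω.2)).card : ℝ) /
    ((sampleSpace X q m).card : ℝ)

end RainbowThreshold

/-! The proof is a coloured version of the Park–Pham minimum-fragment argument. Replace the uniform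
`m`-subset by a binomial one: each element is present with probability `ρ` and has a uniform colour,
so the present elements form a random subset of `X × K` in which no element has two colours. Rainbow
copies of edges of `H` are then ordinary edges of a hypergraph `R` on `X × K`.

`exists_rainbow_hypergraph` builds `R`: colour every edge of `H` injectively, then permute the `q`
colours in all ways. A random pair (edge, permutation) yields a coloured edge containing a given `S`
with probability at most `(3 / (κ q)) ^ |S|`, so by a union bound every cover of `R` has cost at
least `1` at the weight `s = 3 / (κ q)`.

`mul_one_sub_edgeProb_le` turns expensive covers into a likely edge. Expose a random `A` and replace
each edge `S` by a smallest set `S' \ A` with `S'` an edge inside `A ∪ S`. Large fragments have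
small expected cost: forcing `T` into the sample turns the event that `T` is a fragment into the
event that `T` lies in one edge determined by the sample, and that edge has few subsets. The large
fragments are charged to the cover, and the small ones are the edges for the next round. About `log₂
r` rounds reduce all sizes to zero. If the empty fragment never appeared, the charged fragments
would cover `R`, so the failure probability is at most their expected cost.

Separate rounds may give one element two colours. Since an edge uses at most one colour per element,
`colExp_union_le_edgeProb` can still merge them into a single round. Finally
`sum_binomial_weight_le` compares the binomial subset with `X_m` by monotonicity, which gives
failure probability at most `8 / log r`. -/

namespace RainbowThreshold

open Finset

/-! ### Expectations over independent coordinates. -/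

section ProductExpectation

variable {ι Ω : Type*} [Fintype ι] [DecidableEq ι] [Fintype Ω]

/-- The expectation of `F` when the coordinates of `ω : ι → Ω` are independent and the coordinate
`i` has the law with weights `w i`. -/
noncomputable def prodExp (w : ι → Ω → ℝ) (F : (ι → Ω) → ℝ) : ℝ :=
  ∑ ω, (∏ i, w i (ω i)) * F ω

lemma prodExp_const (w : ι → Ω → ℝ) (hw : ∀ i, ∑ a, w i a = 1) (c : ℝ) :
    prodExp w (fun _ => c) = c := by
  have h := Finset.prod_univ_sum (fun _ : ι => (univ : Finset Ω)) w
  rw [Fintype.piFinset_univ] at h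
  rw [prodExp, ← Finset.sum_mul, ← h]
  simp [hw]

lemma prodExp_mono {w : ι → Ω → ℝ} (hw : ∀ i a, 0 ≤ w i a) {F G : (ι → Ω) → ℝ}
    (h : ∀ ω, F ω ≤ G ω) : prodExp w F ≤ prodExp w G :=
  Finset.sum_le_sum fun ω _ =>
    mul_le_mul_of_nonneg_left (h ω) (Finset.prod_nonneg fun i _ => hw i _)

lemma prodExp_sum {α : Type*} (s : Finset α) (w : ι → Ω → ℝ) (F : α → (ι → Ω) → ℝ) :
    prodExp w (fun ω => ∑ a ∈ s, F a ω) = ∑ a ∈ s, prodExp w (F a) := by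
  simp only [prodExp, Finset.mul_sum]
  exact Finset.sum_comm

lemma prodExp_add (w : ι → Ω → ℝ) (F G : (ι → Ω) → ℝ) :
    prodExp w (fun ω => F ω + G ω) = prodExp w F + prodExp w G := by
  simp only [prodExp, mul_add, Finset.sum_add_distrib]

lemma prodExp_const_mul (w : ι → Ω → ℝ) (c : ℝ) (F : (ι → Ω) → ℝ) :
    prodExp w (fun ω => c * F ω) = c * prodExp w F := by
  simp only [prodExp, Finset.mul_sum]
  exact Finset.sum_congr rfl fun ω _ => by ring

/-- Changing the law of one coordinate amounts to resampling that coordinate. -/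
lemma prodExp_update (w : ι → Ω → ℝ) (i : ι) (hw : ∑ a, w i a = 1) (u : Ω → ℝ)
    (F : (ι → Ω) → ℝ) :
    prodExp (Function.update w i u) F =
      prodExp w (fun ω => ∑ a, u a * F (Function.update ω i a)) := by
  -- Draw a spare value for coordinate `i` and exchange it with the current one. This involution
  -- carries one product measure on the enlarged space to the other.
  let e : (ι → Ω) × Ω ≃ (ι → Ω) × Ω :=
    { toFun := fun p => (Function.update p.1 i p.2, p.1 i)
      invFun := fun p => (Function.update p.1 i p.2, p.1 i)
      left_inv := fun p => by simp
      right_inv := fun p => by simp }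
  have hprod (v : ι → Ω → ℝ) (ω : ι → Ω) :
      ∏ j, v j (ω j) = v i (ω i) * ∏ j ∈ univ.erase i, v j (ω j) :=
    (Finset.mul_prod_erase univ (fun j => v j (ω j)) (Finset.mem_univ i)).symm
  have hleft : prodExp (Function.update w i u) F =
      ∑ p : (ι → Ω) × Ω, (∏ j, Function.update w i u j (p.1 j)) * w i p.2 * F p.1 := by
    rw [Fintype.sum_prod_type]
    refine Finset.sum_congr rfl fun ω _ => ?_
    dsimp only
    rw [← Finset.sum_mul, ← Finset.mul_sum, hw, mul_one]
  have hright : prodExp w (fun ω => ∑ a, u a * F (Function.update ω i a)) =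
      ∑ p : (ι → Ω) × Ω, (∏ j, w j (p.1 j)) * (u p.2 * F (Function.update p.1 i p.2)) := by
    rw [Fintype.sum_prod_type]
    simp only [prodExp, Finset.mul_sum]
  rw [hleft, hright]
  refine (Fintype.sum_equiv e _ _ fun p => ?_).symm
  change _ = (∏ j, Function.update w i u j (Function.update p.1 i p.2 j)) * w i (p.1 i) *
    F (Function.update p.1 i p.2)
  rw [hprod w p.1, hprod (Function.update w i u)]
  have : ∏ j ∈ univ.erase i, Function.update w i u j (Function.update p.1 i p.2 j) =
      ∏ j ∈ univ.erase i, w j (p.1 j) :=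
    Finset.prod_congr rfl fun j hj => by
      rw [Function.update_of_ne (Finset.ne_of_mem_erase hj),
        Function.update_of_ne (Finset.ne_of_mem_erase hj)]
  rw [this, Function.update_self, Function.update_self]
  ring

lemma prodExp_resample (w : ι → Ω → ℝ) (i : ι) (hw : ∑ a, w i a = 1) (F : (ι → Ω) → ℝ) :
    prodExp w F = prodExp w (fun ω => ∑ a, w i a * F (Function.update ω i a)) := by
  rw [← prodExp_update w i hw, Function.update_eq_self]

/-- Conditioning on the values of the coordinates in `D` amounts to overwriting them. -/
lemma prodExp_piecewise [DecidableEq Ω] (w : ι → Ω → ℝ) (hw : ∀ i, ∑ a, w i a = 1) (τ : ι → Ω)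
    (D : Finset ι) (F : (ι → Ω) → ℝ) :
    (∏ i ∈ D, w i (τ i)) * prodExp w (fun ω => F (D.piecewise τ ω)) =
      prodExp w (fun ω => if ∀ i ∈ D, ω i = τ i then F ω else 0) := by
  induction D using Finset.induction_on generalizing F with
  | empty => simp
  | insert i D hi ih =>
    rw [Finset.prod_insert hi]
    have h1 := ih (fun ω => F (Function.update ω i (τ i)))
    have h2 : prodExp w (fun ω => if ∀ j ∈ insert i D, ω j = τ j then F ω else 0) =
        prodExp w (fun ω => w i (τ i) *
          if ∀ j ∈ D, ω j = τ j then F (Function.update ω i (τ i)) else 0) := by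
      rw [prodExp_resample w i (hw i)]
      congr 1
      ext ω
      rw [Finset.sum_eq_single (τ i)]
      · congr 1
        refine if_congr ?_ rfl rfl
        simp only [Finset.forall_mem_insert, Function.update_self, true_and]
        refine forall₂_congr fun j hj => ?_
        rw [Function.update_of_ne (ne_of_mem_of_not_mem hj hi)]
      · intro b _ hb
        rw [if_neg, mul_zero]
        intro h
        exact hb (by simpa using h i (Finset.mem_insert_self i D))
      · simp
    rw [h2, prodExp_const_mul, ← h1, mul_assoc]
    simp only [Finset.piecewise_insert]

end ProductExpectation

/-! ### Random coloured subsets and the merging of two rounds. -/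

section ColouredSubset

set_option linter.unusedSectionVars false

variable {ι K : Type*} [Fintype ι] [DecidableEq ι] [Fintype K] [DecidableEq K]

/-- The law of one coordinate: it is present with probability `ρ`, and independently of that it
has a uniform colour. -/
noncomputable def colWeight (K : Type*) [Fintype K] (ρ : ℝ) (a : Bool × K) : ℝ :=
  (if a.1 then ρ else 1 - ρ) / Fintype.card K

/-- The pairs (element, colour) of the elements that are present. -/
def colGraph (ω : ι → Bool × K) : Finset (ι × K) :=
  univ.filter fun v => ω v.1 = (true, v.2)

/-- The expectation over a random coloured subset in which `i` is present with probability
`ρ i`. -/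
noncomputable def colExp (ρ : ι → ℝ) (F : (ι → Bool × K) → ℝ) : ℝ :=
  prodExp (fun i => colWeight K (ρ i)) F

/-- The indicator of `A` containing an edge of `H`. -/
noncomputable def edgeInd {V : Type*} [DecidableEq V] (H : Finset (Finset V)) (A : Finset V) : ℝ :=
  if ∃ S ∈ H, S ⊆ A then 1 else 0

/-- The probability that the random coloured subset contains an edge of `H`. -/
noncomputable def edgeProb (ρ : ℝ) (H : Finset (Finset (ι × K))) : ℝ :=
  colExp (fun _ => ρ) fun ω => edgeInd H (colGraph ω)

/-- No element carries two colours in an edge of `H`. -/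
def Functional (H : Finset (Finset (ι × K))) : Prop :=
  ∀ S ∈ H, Set.InjOn Prod.fst (S : Set (ι × K))

lemma mem_colGraph {ω : ι → Bool × K} {v : ι × K} : v ∈ colGraph ω ↔ ω v.1 = (true, v.2) := by
  simp [colGraph]

lemma edgeInd_nonneg {V : Type*} [DecidableEq V] (H : Finset (Finset V)) (A : Finset V) :
    0 ≤ edgeInd H A := by
  unfold edgeInd; split_ifs <;> norm_num

lemma edgeInd_le_one {V : Type*} [DecidableEq V] (H : Finset (Finset V)) (A : Finset V) :
    edgeInd H A ≤ 1 := by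
  unfold edgeInd; split_ifs <;> norm_num

lemma edgeInd_mono {V : Type*} [DecidableEq V] {H H' : Finset (Finset V)} {A B : Finset V}
    (h : (∃ S ∈ H, S ⊆ A) → ∃ S ∈ H', S ⊆ B) : edgeInd H A ≤ edgeInd H' B := by
  by_cases hA : ∃ S ∈ H, S ⊆ A
  · simp [edgeInd, hA, h hA]
  · rw [edgeInd, if_neg hA]
    exact edgeInd_nonneg _ _

lemma sum_colWeight_mul (ρ : ℝ) (g : Bool × K → ℝ) :
    ∑ a, colWeight K ρ a * g a =
      ρ / Fintype.card K * ∑ c, g (true, c) + (1 - ρ) / Fintype.card K * ∑ c, g (false, c) := by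
  simp [Fintype.sum_prod_type, colWeight, Finset.mul_sum]

lemma sum_colWeight [Nonempty K] (ρ : ℝ) : ∑ a, colWeight K ρ a = 1 := by
  have h := sum_colWeight_mul (K := K) ρ fun _ => 1
  simp only [mul_one] at h
  rw [h]
  have : (Fintype.card K : ℝ) ≠ 0 := by exact_mod_cast Fintype.card_ne_zero
  simp only [Finset.sum_const, Finset.card_univ, nsmul_eq_mul, mul_one]
  field_simp
  ring

lemma colWeight_nonneg {ρ : ℝ} (h0 : 0 ≤ ρ) (h1 : ρ ≤ 1) (a : Bool × K) :
    0 ≤ colWeight K ρ a := by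
  unfold colWeight
  have : 0 ≤ 1 - ρ := by linarith
  split_ifs <;> positivity

/-- A set of edges in which no element has two colours: two colours of the same element help
no more than the two colours separately. -/
lemma edgeInd_insert_insert {H : Finset (Finset (ι × K))} (hH : Functional H)
    (A : Finset (ι × K)) (i : ι) (a b : K) :
    edgeInd H (insert (i, a) (insert (i, b) A)) + edgeInd H A ≤
      edgeInd H (insert (i, a) A) + edgeInd H (insert (i, b) A) := by
  have ha : edgeInd H A ≤ edgeInd H (insert (i, a) A) :=
    edgeInd_mono fun ⟨S, hS, h⟩ => ⟨S, hS, h.trans (Finset.subset_insert _ _)⟩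
  have hb : edgeInd H A ≤ edgeInd H (insert (i, b) A) :=
    edgeInd_mono fun ⟨S, hS, h⟩ => ⟨S, hS, h.trans (Finset.subset_insert _ _)⟩
  by_cases h : ∃ S ∈ H, S ⊆ insert (i, a) (insert (i, b) A)
  · obtain ⟨S, hS, hSA⟩ := h
    have hle := edgeInd_le_one H (insert (i, a) (insert (i, b) A))
    -- An edge holds at most one of two different pairs above `i`, so it survives the removal of the
    -- other.
    by_cases hbS : (i, b) ∈ S
    · have hsub : S ⊆ insert (i, b) A := by
        intro v hv
        have hv' := hSA hv
        rw [Finset.mem_insert] at hv'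
        rcases hv' with rfl | hv'
        · rw [hH S hS hv hbS rfl]
          exact Finset.mem_insert_self _ _
        · exact hv'
      have : edgeInd H (insert (i, b) A) = 1 := if_pos ⟨S, hS, hsub⟩
      linarith
    · have hsub : S ⊆ insert (i, a) A := by
        intro v hv
        have hv' := hSA hv
        simp only [Finset.mem_insert] at hv' ⊢
        rcases hv' with hv' | rfl | hv'
        · exact Or.inl hv'
        · exact absurd hv hbS
        · exact Or.inr hv'
      have : edgeInd H (insert (i, a) A) = 1 := if_pos ⟨S, hS, hsub⟩
      linarith
  · have : edgeInd H (insert (i, a) (insert (i, b) A)) = 0 := if_neg h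
    linarith [edgeInd_nonneg H (insert (i, b) A)]

lemma colGraph_update_true (ω : ι → Bool × K) (i : ι) (c : K) :
    colGraph (Function.update ω i (true, c)) =
      insert (i, c) ((colGraph ω).filter fun v => v.1 ≠ i) := by
  ext ⟨j, d⟩
  rw [mem_colGraph]
  by_cases hj : j = i
  · subst hj
    simp [eq_comm]
  · simp [hj, mem_colGraph]

lemma colGraph_update_false (ω : ι → Bool × K) (i : ι) (c : K) :
    colGraph (Function.update ω i (false, c)) = (colGraph ω).filter fun v => v.1 ≠ i := by
  ext ⟨j, d⟩
  rw [mem_colGraph]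
  by_cases hj : j = i
  · subst hj
    simp
  · simp [hj, mem_colGraph]

/-- Merging the two rounds at one coordinate does not decrease the probability of an edge. -/
lemma sum_colWeight_union_le [Nonempty K] {H : Finset (Finset (ι × K))} (hH : Functional H)
    {r₁ r₂ : ℝ} (h₁ : 0 ≤ r₁) (h₂ : 0 ≤ r₂) (i : ι) (ω₁ ω₂ : ι → Bool × K) :
    ∑ a, colWeight K r₁ a * ∑ b, colWeight K r₂ b *
        edgeInd H (colGraph (Function.update ω₁ i a) ∪ colGraph (Function.update ω₂ i b)) ≤
      ∑ a, colWeight K (r₁ + r₂) a * ∑ b, colWeight K 0 b *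
        edgeInd H (colGraph (Function.update ω₁ i a) ∪ colGraph (Function.update ω₂ i b)) := by
  simp only [sum_colWeight_mul, colGraph_update_true, colGraph_update_false, Finset.insert_union,
    Finset.union_insert]
  set A := (colGraph ω₁).filter (fun v => v.1 ≠ i) ∪ (colGraph ω₂).filter (fun v => v.1 ≠ i)
  set q : ℝ := (Fintype.card K : ℝ) with hq
  have hq0 : 0 < q := by rw [hq]; exact_mod_cast Fintype.card_pos
  set S := ∑ c, edgeInd H (insert (i, c) A) with hS
  -- Two colours can arise only when both rounds select `i`. This is the only term in which the two
  -- sides differ after expansion.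
  have hcross : ∑ a, ∑ b, edgeInd H (insert (i, b) (insert (i, a) A)) ≤
      2 * q * S - q ^ 2 * edgeInd H A := by
    calc ∑ a, ∑ b, edgeInd H (insert (i, b) (insert (i, a) A))
        ≤ ∑ a : K, ∑ b : K, (edgeInd H (insert (i, a) A) + edgeInd H (insert (i, b) A) -
            edgeInd H A) :=
          Finset.sum_le_sum fun a _ => Finset.sum_le_sum fun b _ => by
            linarith [edgeInd_insert_insert hH A i b a]
      _ = 2 * q * S - q ^ 2 * edgeInd H A := by
          simp only [Finset.sum_sub_distrib, Finset.sum_add_distrib, Finset.sum_const,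
            Finset.card_univ, nsmul_eq_mul, ← Finset.mul_sum, ← hq, ← hS]
          ring
  simp only [Finset.sum_add_distrib, Finset.sum_const, Finset.card_univ, nsmul_eq_mul,
    ← Finset.mul_sum, ← hq, ← hS]
  have hc : 0 ≤ r₁ * r₂ / q ^ 2 := by positivity
  have := mul_le_mul_of_nonneg_left hcross hc
  have e : r₁ * r₂ / q ^ 2 * (2 * q * S - q ^ 2 * edgeInd H A) =
      2 * r₁ * r₂ * S / q - r₁ * r₂ * edgeInd H A := by
    field_simp
  rw [e] at this
  set T := ∑ a, ∑ b, edgeInd H (insert (i, b) (insert (i, a) A))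
  have e1 : r₁ / q * (r₂ / q * T + (1 - r₂) / q * (q * S)) +
      (1 - r₁) / q * (q * (r₂ / q * S + (1 - r₂) / q * (q * edgeInd H A))) =
      r₁ * r₂ / q ^ 2 * T + (r₁ * (1 - r₂) * S / q + (1 - r₁) * r₂ * S / q +
        (1 - r₁) * (1 - r₂) * edgeInd H A) := by
    field_simp
    ring
  -- The merged round equals the two-round expression with its cross term replaced by the upper
  -- bound from `hcross`.
  have e2 : (r₁ + r₂) / q * (0 / q * T + (1 - 0) / q * (q * S)) +
      (1 - (r₁ + r₂)) / q * (q * (0 / q * S + (1 - 0) / q * (q * edgeInd H A))) =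
      (2 * r₁ * r₂ * S / q - r₁ * r₂ * edgeInd H A) +
      (r₁ * (1 - r₂) * S / q + (1 - r₁) * r₂ * S / q +
        (1 - r₁) * (1 - r₂) * edgeInd H A) := by
    field_simp
    ring
  refine le_trans (le_of_eq ?_) (le_trans (e1.le.trans ((add_le_add_left this _).trans e2.ge))
    (le_of_eq ?_))
  · ring
  · ring

lemma colExp_update [Nonempty K] (ρ : ι → ℝ) (i : ι) (r : ℝ) (F : (ι → Bool × K) → ℝ) :
    colExp (Function.update ρ i r) F =
      colExp ρ (fun ω => ∑ a, colWeight K r a * F (Function.update ω i a)) := by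
  unfold colExp
  rw [← prodExp_update _ i (sum_colWeight _)]
  congr 1
  ext j a
  by_cases hj : j = i
  · subst hj; simp
  · simp [hj]

lemma colExp_mono {ρ : ι → ℝ} (h0 : ∀ i, 0 ≤ ρ i) (h1 : ∀ i, ρ i ≤ 1)
    {F G : (ι → Bool × K) → ℝ} (h : ∀ ω, F ω ≤ G ω) : colExp ρ F ≤ colExp ρ G :=
  prodExp_mono (fun i a => colWeight_nonneg (h0 i) (h1 i) a) h

/-- Isolates coordinate `i` in both rounds, so that `sum_colWeight_union_le` applies with all other
coordinates frozen. -/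
lemma colExp_update_update [Nonempty K] (ρ₁ ρ₂ : ι → ℝ) (i : ι) (r₁ r₂ : ℝ)
    (f : (ι → Bool × K) → (ι → Bool × K) → ℝ) :
    colExp (Function.update ρ₁ i r₁) (fun ω₁ => colExp (Function.update ρ₂ i r₂) (f ω₁)) =
      colExp ρ₁ (fun ω₁ => colExp ρ₂ fun ω₂ =>
        ∑ a, colWeight K r₁ a * ∑ b, colWeight K r₂ b *
          f (Function.update ω₁ i a) (Function.update ω₂ i b)) := by
  rw [colExp_update]
  congr 1
  ext ω₁
  simp only [colExp_update]
  simp only [colExp, prodExp_sum, prodExp_const_mul]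

lemma colExp_zero [Nonempty K] (F : Finset (ι × K) → ℝ) :
    colExp (fun _ : ι => (0 : ℝ)) (fun ω : ι → Bool × K => F (colGraph ω)) = F ∅ := by
  rw [← prodExp_const (fun _ : ι => colWeight K 0) (fun _ => sum_colWeight 0) (F ∅)]
  refine Finset.sum_congr rfl fun ω _ => ?_
  dsimp only
  by_cases h : ∃ i, (ω i).1 = true
  · obtain ⟨i, hi⟩ := h
    have : ∏ j, colWeight K 0 (ω j) = 0 :=
      Finset.prod_eq_zero (Finset.mem_univ i) (by simp [colWeight, hi])
    rw [this]
    simp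
  · have : colGraph ω = ∅ := by
      ext v
      rw [mem_colGraph]
      push Not at h
      constructor
      · intro hv
        exact absurd (by rw [hv]) (h v.1)
      · simp
    rw [this]

/-- Two independent rounds are dominated by one round with the sum of the densities. -/
lemma colExp_union_le_edgeProb [Nonempty K] {H : Finset (Finset (ι × K))} (hH : Functional H)
    {r₁ r₂ : ℝ} (h₁ : 0 ≤ r₁) (h₂ : 0 ≤ r₂) (h : r₁ + r₂ ≤ 1) :
    colExp (fun _ => r₁) (fun ω₁ : ι → Bool × K => colExp (fun _ => r₂) fun ω₂ =>
      edgeInd H (colGraph ω₁ ∪ colGraph ω₂)) ≤ edgeProb (r₁ + r₂) H := by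
  -- Hybrid argument: the coordinates in `D` are already merged, and one more is merged at each
  -- step. For `D = univ` the second round has density zero and selects nothing.
  have key : ∀ D : Finset ι,
      colExp (fun _ => r₁) (fun ω₁ : ι → Bool × K => colExp (fun _ => r₂) fun ω₂ =>
        edgeInd H (colGraph ω₁ ∪ colGraph ω₂)) ≤
      colExp (D.piecewise (fun _ => r₁ + r₂) fun _ => r₁)
        (fun ω₁ : ι → Bool × K => colExp (D.piecewise (fun _ => 0) fun _ => r₂) fun ω₂ =>
        edgeInd H (colGraph ω₁ ∪ colGraph ω₂)) := by
    intro D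
    induction D using Finset.induction_on with
    | empty => simp
    | insert i D hi ih =>
      refine ih.trans ?_
      rw [Finset.piecewise_insert, Finset.piecewise_insert]
      set ρ₁ := D.piecewise (fun _ => r₁ + r₂) fun _ => r₁ with hρ₁
      set ρ₂ := D.piecewise (fun _ => (0 : ℝ)) fun _ => r₂ with hρ₂
      have e₁ : Function.update ρ₁ i r₁ = ρ₁ := by
        rw [Function.update_eq_self_iff, hρ₁, Finset.piecewise_eq_of_notMem _ _ _ hi]
      have e₂ : Function.update ρ₂ i r₂ = ρ₂ := by
        rw [Function.update_eq_self_iff, hρ₂, Finset.piecewise_eq_of_notMem _ _ _ hi]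
      have b₁ : ∀ j, 0 ≤ ρ₁ j ∧ ρ₁ j ≤ 1 := by
        intro j
        by_cases hj : j ∈ D <;> simp [hρ₁, hj] <;> constructor <;> linarith
      have b₂ : ∀ j, 0 ≤ ρ₂ j ∧ ρ₂ j ≤ 1 := by
        intro j
        by_cases hj : j ∈ D <;> simp [hρ₂, hj]
        constructor <;> linarith
      conv_lhs => rw [← e₁, ← e₂]
      rw [colExp_update_update, colExp_update_update]
      refine colExp_mono (fun j => (b₁ j).1) (fun j => (b₁ j).2) fun ω₁ => ?_
      refine colExp_mono (fun j => (b₂ j).1) (fun j => (b₂ j).2) fun ω₂ => ?_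
      exact sum_colWeight_union_le hH h₁ h₂ i ω₁ ω₂
  refine (key univ).trans (le_of_eq ?_)
  simp only [Finset.piecewise_univ, edgeProb]
  congr 1
  ext ω₁
  rw [colExp_zero (fun A => edgeInd H (colGraph ω₁ ∪ A)), Finset.union_empty]

end ColouredSubset

/-! ### Minimum fragments and the iteration. -/

section Fragments

set_option linter.unusedSectionVars false

/-- Every edge of `H` contains a member of `G`. -/
def IsCover {V : Type*} (G H : Finset (Finset V)) : Prop :=
  ∀ S ∈ H, ∃ T ∈ G, T ⊆ S

/-- `frag A S` is a set `S' \ A` of least size among the edges `S'` of `H` inside `A ∪ S`. -/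
structure IsFragment {V : Type*} [DecidableEq V] (H : Finset (Finset V))
    (frag : Finset V → Finset V → Finset V) : Prop where
  exists_eq : ∀ A, ∀ S ∈ H, ∃ S' ∈ H, S' ⊆ A ∪ S ∧ frag A S = S' \ A
  card_le : ∀ A, ∀ S ∈ H, ∀ S' ∈ H, S' ⊆ A ∪ S → (frag A S).card ≤ (S' \ A).card

lemma exists_isFragment {V : Type*} [DecidableEq V] (H : Finset (Finset V)) :
    ∃ frag, IsFragment H frag := by
  have h : ∀ A S : Finset V, ∃ T : Finset V, S ∈ H →
      (∃ S' ∈ H, S' ⊆ A ∪ S ∧ T = S' \ A) ∧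
        ∀ S' ∈ H, S' ⊆ A ∪ S → T.card ≤ (S' \ A).card := by
    intro A S
    by_cases hS : S ∈ H
    · obtain ⟨S', hS', hmin⟩ := Finset.exists_min_image (H.filter fun S' => S' ⊆ A ∪ S)
        (fun S' => (S' \ A).card) ⟨S, by simp [hS]⟩
      rw [Finset.mem_filter] at hS'
      exact ⟨S' \ A, fun _ => ⟨⟨S', hS'.1, hS'.2, rfl⟩,
        fun S'' h1 h2 => hmin S'' (by simp [h1, h2])⟩⟩
    · exact ⟨∅, fun h => absurd h hS⟩
  choose frag hfrag using h
  exact ⟨frag, fun A S hS => (hfrag A S hS).1, fun A S hS => (hfrag A S hS).2⟩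

lemma IsFragment.subset {V : Type*} [DecidableEq V] {H : Finset (Finset V)}
    {frag : Finset V → Finset V → Finset V} (h : IsFragment H frag) (A : Finset V)
    {S : Finset V} (hS : S ∈ H) : frag A S ⊆ S := by
  obtain ⟨S', -, hsub, he⟩ := h.exists_eq A S hS
  rw [he]
  intro v hv
  rw [Finset.mem_sdiff] at hv
  exact (Finset.mem_union.1 (hsub hv.1)).resolve_left hv.2

variable {ι K : Type*} [Fintype ι] [DecidableEq ι] [Fintype K] [DecidableEq K] [Nonempty K]

lemma colExp_nonneg {ρ : ℝ} (h0 : 0 ≤ ρ) (h1 : ρ ≤ 1) {F : (ι → Bool × K) → ℝ}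
    (h : ∀ ω, 0 ≤ F ω) : 0 ≤ colExp (fun _ => ρ) F := by
  refine le_trans ?_ (colExp_mono (fun _ => h0) (fun _ => h1) h)
  exact (prodExp_const _ (fun _ => sum_colWeight ρ) 0).ge

/-- The event that `T` is a fragment is, after forcing `T` into the random set, the event that
`T` lies in a prescribed edge. -/
lemma pow_mul_colExp_fragment_le {H : Finset (Finset (ι × K))} (hH : Functional H)
    {frag : Finset (ι × K) → Finset (ι × K) → Finset (ι × K)} (hfrag : IsFragment H frag)
    {pick : Finset (ι × K) → Finset (ι × K)}
    (hpick : ∀ A, (∃ S ∈ H, S ⊆ A) → pick A ∈ H ∧ pick A ⊆ A)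
    {ρ : ℝ} (h0 : 0 ≤ ρ) (h1 : ρ ≤ 1) (T : Finset (ι × K)) :
    (ρ / Fintype.card K) ^ T.card *
        colExp (fun _ => ρ) (fun ω => if T ∈ H.image (frag (colGraph ω)) then 1 else 0) ≤
      colExp (fun _ => ρ) (fun ω => if T ⊆ pick (colGraph ω) then 1 else 0) := by
  have hnonneg : 0 ≤ colExp (fun _ => ρ)
      (fun ω : ι → Bool × K => if T ⊆ pick (colGraph ω) then (1 : ℝ) else 0) :=
    colExp_nonneg h0 h1 fun ω => by split_ifs <;> norm_num
  by_cases hT : Set.InjOn Prod.fst (T : Set (ι × K))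
  swap
  -- A fragment lies in an edge, so a `T` with two colours on one element never occurs.
  · have : ∀ ω : ι → Bool × K, T ∉ H.image (frag (colGraph ω)) := by
      intro ω hmem
      obtain ⟨S, hS, rfl⟩ := Finset.mem_image.1 hmem
      exact hT ((hH S hS).mono (by exact_mod_cast hfrag.subset _ hS))
    simp only [this, if_false]
    unfold colExp at hnonneg ⊢
    rwa [prodExp_const _ (fun _ => sum_colWeight ρ), mul_zero]
  set D := T.image Prod.fst with hD
  have hτ : ∀ i, ∃ c : K, i ∈ D → (i, c) ∈ T := by
    intro i
    by_cases hi : i ∈ D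
    · obtain ⟨v, hv, rfl⟩ := Finset.mem_image.1 hi
      exact ⟨v.2, fun _ => hv⟩
    · exact ⟨Classical.arbitrary K, fun h => absurd h hi⟩
  choose col hcol using hτ
  set τ : ι → Bool × K := fun i => (true, col i) with hτdef
  have hprod : ∏ i ∈ D, colWeight K ρ (τ i) = (ρ / Fintype.card K) ^ T.card := by
    simp [hτdef, colWeight, hD, Finset.card_image_of_injOn hT, div_pow]
  have hforce : ∀ ω : ι → Bool × K, T ∈ H.image (frag (colGraph ω)) →
      T ⊆ pick (colGraph (D.piecewise τ ω)) := by
    intro ω hmem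
    obtain ⟨S, hS, rfl⟩ := Finset.mem_image.1 hmem
    obtain ⟨S', hS', hsub, he⟩ := hfrag.exists_eq (colGraph ω) S hS
    set A := colGraph ω
    set T := frag A S
    set Z := colGraph (D.piecewise τ ω)
    have hTS' : T ⊆ S' := he ▸ Finset.sdiff_subset
    -- Overwriting may erase pairs of `A` above `D`, but none of `S'`: above `D` the edge `S'` has
    -- the same colours as `T`, because it contains `T` and has one colour per element.
    have hS'Z : S' ⊆ Z := by
      intro v hv
      rw [mem_colGraph]
      by_cases hvD : v.1 ∈ D
      · rw [Finset.piecewise_eq_of_mem _ _ _ hvD]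
        have := hH S' hS' hv (hTS' (hcol v.1 hvD)) rfl
        exact Prod.ext rfl (by rw [this])
      · rw [Finset.piecewise_eq_of_notMem _ _ _ hvD, ← mem_colGraph]
        by_contra hvA
        have : v ∈ T := by rw [he]; exact Finset.mem_sdiff.2 ⟨hv, hvA⟩
        exact hvD (Finset.mem_image_of_mem _ this)
    have hZ : Z ⊆ A ∪ T := by
      intro v hv
      rw [mem_colGraph] at hv
      by_cases hvD : v.1 ∈ D
      · rw [Finset.piecewise_eq_of_mem _ _ _ hvD] at hv
        have h2 : col v.1 = v.2 := congrArg Prod.snd hv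
        have := hcol v.1 hvD
        rw [h2] at this
        exact Finset.mem_union_right _ this
      · rw [Finset.piecewise_eq_of_notMem _ _ _ hvD, ← mem_colGraph] at hv
        exact Finset.mem_union_left _ hv
    -- The picked edge lies in `A ∪ S`, so it competes with `S'` in the minimum. Its part outside
    -- `A` is contained in `T` and no smaller than `T`, hence equal to `T`.
    obtain ⟨hpH, hpZ⟩ := hpick Z ⟨S', hS', hS'Z⟩
    have hcard := hfrag.card_le A S hS _ hpH
      ((hpZ.trans hZ).trans (Finset.union_subset_union_right (hfrag.subset A hS)))
    have hsdiff : pick Z \ A ⊆ T := by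
      exact sdiff_le_iff.2 (hpZ.trans hZ)
    rw [← Finset.eq_of_subset_of_card_le hsdiff hcard]
    exact Finset.sdiff_subset
  rw [← hprod]
  calc (∏ i ∈ D, colWeight K ρ (τ i)) *
        colExp (fun _ => ρ) (fun ω => if T ∈ H.image (frag (colGraph ω)) then 1 else 0)
      ≤ (∏ i ∈ D, colWeight K ρ (τ i)) * colExp (fun _ => ρ)
          (fun ω => if T ⊆ pick (colGraph (D.piecewise τ ω)) then 1 else 0) := by
        refine mul_le_mul_of_nonneg_left (colExp_mono (fun _ => h0) (fun _ => h1) fun ω => ?_)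
          (Finset.prod_nonneg fun i _ => colWeight_nonneg h0 h1 _)
        by_cases hm : T ∈ H.image (frag (colGraph ω))
        · simp [hm, hforce ω hm]
        · rw [if_neg hm]
          split_ifs <;> norm_num
    _ = colExp (fun _ => ρ) (fun ω => if ∀ i ∈ D, ω i = τ i then
          (if T ⊆ pick (colGraph ω) then 1 else 0) else 0) :=
        prodExp_piecewise (fun _ => colWeight K ρ) (fun _ => sum_colWeight ρ) τ D
          (fun ω => if T ⊆ pick (colGraph ω) then 1 else 0)
    _ ≤ colExp (fun _ => ρ) (fun ω => if T ⊆ pick (colGraph ω) then 1 else 0) := by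
        refine colExp_mono (fun _ => h0) (fun _ => h1) fun ω => ?_
        split_ifs <;> norm_num

/-- The expected cost of the large fragments. -/
lemma colExp_cost_fragment_le {H : Finset (Finset (ι × K))} (hH : Functional H) {l : ℕ}
    (hl : IsBounded H l)
    {frag : Finset (ι × K) → Finset (ι × K) → Finset (ι × K)} (hfrag : IsFragment H frag)
    {ρ s : ℝ} (h0 : 0 < ρ) (h1 : ρ ≤ 1) (hs : 0 ≤ s) (hsρ : s * Fintype.card K ≤ ρ) (a : ℕ) :
    colExp (fun _ => ρ) (fun ω => ∑ T ∈ (H.image (frag (colGraph ω))).filter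
        (fun T => a ≤ T.card), s ^ T.card) ≤ 2 ^ l * (s * Fintype.card K / ρ) ^ a := by
  -- The picked edge depends on the sample alone, so at most `2 ^ l` sets `T` lie in it. The default
  -- `∅` keeps the size bound when the sample contains no edge.
  have hpick : ∃ pick : Finset (ι × K) → Finset (ι × K), (∀ A, (pick A).card ≤ l) ∧
      ∀ A, (∃ S ∈ H, S ⊆ A) → pick A ∈ H ∧ pick A ⊆ A := by
    have h : ∀ A : Finset (ι × K), ∃ P : Finset (ι × K), P.card ≤ l ∧
        ((∃ S ∈ H, S ⊆ A) → P ∈ H ∧ P ⊆ A) := by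
      intro A
      by_cases hA : ∃ S ∈ H, S ⊆ A
      · obtain ⟨S, hS, hSA⟩ := hA
        exact ⟨S, hl S hS, fun _ => ⟨hS, hSA⟩⟩
      · exact ⟨∅, by simp, fun h => absurd h hA⟩
    choose pick h1 h2 using h
    exact ⟨pick, h1, h2⟩
  obtain ⟨pick, hpl, hpick⟩ := hpick
  have hq : (0 : ℝ) < Fintype.card K := by exact_mod_cast Fintype.card_pos
  set x := s * Fintype.card K / ρ with hx
  have hx0 : 0 ≤ x := by positivity
  have hx1 : x ≤ 1 := (div_le_one h0).2 hsρ
  have hterm : ∀ T : Finset (ι × K), s ^ T.card *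
      colExp (fun _ => ρ) (fun ω => if T ∈ H.image (frag (colGraph ω)) then 1 else 0) ≤
      x ^ T.card * colExp (fun _ => ρ) (fun ω => if T ⊆ pick (colGraph ω) then 1 else 0) := by
    intro T
    have hsx : s = x * (ρ / Fintype.card K) := by rw [hx]; field_simp
    rw [hsx, mul_pow, mul_assoc]
    exact mul_le_mul_of_nonneg_left
      (pow_mul_colExp_fragment_le hH hfrag hpick h0.le h1 T) (pow_nonneg hx0 _)
  calc colExp (fun _ => ρ) (fun ω => ∑ T ∈ (H.image (frag (colGraph ω))).filter
        (fun T => a ≤ T.card), s ^ T.card)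
      = ∑ T ∈ univ.filter (fun T : Finset (ι × K) => a ≤ T.card), s ^ T.card *
          colExp (fun _ => ρ) (fun ω => if T ∈ H.image (frag (colGraph ω)) then 1 else 0) := by
        unfold colExp
        simp only [← prodExp_const_mul]
        rw [← prodExp_sum]
        congr 1
        ext ω
        simp only [mul_ite, mul_one, mul_zero]
        rw [← Finset.sum_filter]
        refine Finset.sum_congr ?_ fun _ _ => rfl
        ext T
        simp [and_comm]
    _ ≤ ∑ T ∈ univ.filter (fun T : Finset (ι × K) => a ≤ T.card), x ^ T.card *
          colExp (fun _ => ρ) (fun ω => if T ⊆ pick (colGraph ω) then 1 else 0) :=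
        Finset.sum_le_sum fun T _ => hterm T
    _ = colExp (fun _ => ρ) (fun ω => ∑ T ∈ (pick (colGraph ω)).powerset.filter
          (fun T => a ≤ T.card), x ^ T.card) := by
        unfold colExp
        simp only [← prodExp_const_mul]
        rw [← prodExp_sum]
        congr 1
        ext ω
        simp only [mul_ite, mul_one, mul_zero]
        rw [← Finset.sum_filter]
        refine Finset.sum_congr ?_ fun _ _ => rfl
        ext T
        simp [and_comm]
    _ ≤ colExp (fun _ => ρ) (fun _ : ι → Bool × K => 2 ^ l * x ^ a) := by
        refine colExp_mono (fun _ => h0.le) (fun _ => h1) fun ω => ?_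
        calc ∑ T ∈ (pick (colGraph ω)).powerset.filter (fun T => a ≤ T.card), x ^ T.card
            ≤ ∑ T ∈ (pick (colGraph ω)).powerset.filter (fun T => a ≤ T.card), x ^ a :=
              Finset.sum_le_sum fun T hT =>
                pow_le_pow_of_le_one hx0 hx1 (Finset.mem_filter.1 hT).2
          _ ≤ ∑ T ∈ (pick (colGraph ω)).powerset, x ^ a :=
              Finset.sum_le_sum_of_subset_of_nonneg (Finset.filter_subset _ _)
                fun _ _ _ => pow_nonneg hx0 _
          _ = 2 ^ (pick (colGraph ω)).card * x ^ a := by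
              rw [Finset.sum_const, Finset.card_powerset, nsmul_eq_mul]
              push_cast
              rfl
          _ ≤ 2 ^ l * x ^ a :=
              mul_le_mul_of_nonneg_right (pow_le_pow_right₀ (by norm_num) (hpl _))
                (pow_nonneg hx0 _)
    _ = 2 ^ l * x ^ a := prodExp_const _ (fun _ => sum_colWeight ρ) _

lemma edgeProb_le_one {ρ : ℝ} (h0 : 0 ≤ ρ) (h1 : ρ ≤ 1) (H : Finset (Finset (ι × K))) :
    edgeProb ρ H ≤ 1 := by
  rw [← prodExp_const (fun _ : ι => colWeight K ρ) (fun _ => sum_colWeight ρ) 1]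
  exact prodExp_mono (fun _ => colWeight_nonneg h0 h1) fun ω => edgeInd_le_one _ _

/-- If every cover of `H` is expensive, then the random coloured subset is likely to contain an
edge of `H`. -/
theorem mul_one_sub_edgeProb_le {s : ℝ} (hs : 0 < s) {M : ℕ → ℝ} (hM : ∀ i, 1 ≤ M i) (j : ℕ)
    (H : Finset (Finset (ι × K))) (hH : Functional H) (hj : IsBounded H (2 ^ j - 1)) (c : ℝ)
    (hc : ∀ G, IsCover G H → c ≤ ∑ T ∈ G, s ^ T.card)
    (hρ : 4 * s * Fintype.card K * ∑ i ∈ range j, M i ≤ 1) :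
    c * (1 - edgeProb (4 * s * Fintype.card K * ∑ i ∈ range j, M i) H) ≤
      ∑ i ∈ range j, (M i ^ 2 ^ i)⁻¹ := by
  have hq : (0 : ℝ) < Fintype.card K := by exact_mod_cast Fintype.card_pos
  have hMsum : ∀ j, 0 ≤ ∑ i ∈ range j, M i := fun j =>
    Finset.sum_nonneg fun i _ => zero_le_one.trans (hM i)
  have hnonneg : ∀ j, 0 ≤ ∑ i ∈ range j, (M i ^ 2 ^ i)⁻¹ := fun j =>
    Finset.sum_nonneg fun i _ => inv_nonneg.2 (pow_nonneg (zero_le_one.trans (hM i)) _)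
  induction j generalizing H c with
  | zero =>
    simp only [Finset.range_zero, Finset.sum_empty, mul_zero]
    -- Either the empty edge is present and the probability is one, or `H` is empty and the empty
    -- family is a cover of cost zero.
    have hempty : ∀ S ∈ H, S = ∅ := fun S hS => by simpa using hj S hS
    by_cases h : ∅ ∈ H
    · have hone : edgeProb 0 H = 1 := by
        unfold edgeProb
        rw [colExp_zero (fun A => edgeInd H A)]
        exact if_pos ⟨∅, h, Finset.Subset.refl _⟩
      rw [hone]
      simp
    · have hc0 : c ≤ 0 := by
        have := hc ∅ fun S hS => absurd (hempty S hS ▸ hS) h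
        simpa using this
      exact mul_nonpos_of_nonpos_of_nonneg hc0
        (sub_nonneg.2 (edgeProb_le_one le_rfl zero_le_one H))
  | succ j ih =>
    -- The induction passes on `c` minus the cost of the large fragments, which may be negative.
    rcases lt_or_ge c 0 with hneg | hcnn
    · refine le_trans (mul_nonpos_of_nonpos_of_nonneg hneg.le (sub_nonneg.2
        (edgeProb_le_one ?_ hρ H))) (hnonneg _)
      exact mul_nonneg (by positivity) (hMsum _)
    obtain ⟨frag, hfrag⟩ := exists_isFragment H
    have hMj := hM j
    set r₁ := 4 * s * Fintype.card K * M j with hr₁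
    set r₂ := 4 * s * Fintype.card K * ∑ i ∈ range j, M i with hr₂
    have hsum : 4 * s * Fintype.card K * ∑ i ∈ range (j + 1), M i = r₁ + r₂ := by
      rw [Finset.sum_range_succ, hr₁, hr₂]; ring
    rw [hsum] at hρ ⊢
    have hr₁0 : 0 < r₁ := by positivity
    have hr₂0 : 0 ≤ r₂ := mul_nonneg (by positivity) (hMsum _)
    let next : (ι → Bool × K) → Finset (Finset (ι × K)) := fun ω =>
      (H.image (frag (colGraph ω))).filter fun T => T.card < 2 ^ j
    let large : (ι → Bool × K) → Finset (Finset (ι × K)) := fun ω =>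
      (H.image (frag (colGraph ω))).filter fun T => 2 ^ j ≤ T.card
    have hstep : ∀ ω, c * (1 - edgeProb r₂ (next ω)) ≤
        (∑ T ∈ large ω, s ^ T.card) + ∑ i ∈ range j, (M i ^ 2 ^ i)⁻¹ := by
      intro ω
      have hfun : Functional (next ω) := by
        intro T hT
        obtain ⟨S, hS, rfl⟩ := Finset.mem_image.1 (Finset.mem_filter.1 hT).1
        exact (hH S hS).mono (by exact_mod_cast hfrag.subset _ hS)
      have hbdd : IsBounded (next ω) (2 ^ j - 1) := fun T hT =>
        Nat.le_sub_one_of_lt (Finset.mem_filter.1 hT).2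
      have hcover : ∀ G, IsCover G (next ω) →
          c - ∑ T ∈ large ω, s ^ T.card ≤ ∑ T ∈ G, s ^ T.card := by
        intro G hG
        have hcov : IsCover (G ∪ large ω) H := by
          intro S hS
          have hsub := hfrag.subset (colGraph ω) hS
          have himg : frag (colGraph ω) S ∈ H.image (frag (colGraph ω)) :=
            Finset.mem_image_of_mem _ hS
          rcases lt_or_ge (frag (colGraph ω) S).card (2 ^ j) with hlt | hge
          · obtain ⟨T, hT, hTS⟩ := hG _ (Finset.mem_filter.2 ⟨himg, hlt⟩)
            exact ⟨T, Finset.mem_union_left _ hT, hTS.trans hsub⟩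
          · exact ⟨_, Finset.mem_union_right _ (Finset.mem_filter.2 ⟨himg, hge⟩), hsub⟩
        have h1 := hc _ hcov
        have h2 : ∑ T ∈ G ∪ large ω, s ^ T.card ≤
            ∑ T ∈ G, s ^ T.card + ∑ T ∈ large ω, s ^ T.card := by
          rw [← Finset.sum_union_inter]
          exact le_add_of_nonneg_right (Finset.sum_nonneg fun T _ => pow_nonneg hs.le _)
        linarith
      have h := ih (next ω) hfun hbdd _ hcover (by linarith)
      have hP0 : 0 ≤ edgeProb r₂ (next ω) :=
        colExp_nonneg hr₂0 (by linarith) fun ω => edgeInd_nonneg _ _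
      have hP1 : edgeProb r₂ (next ω) ≤ 1 := edgeProb_le_one hr₂0 (by linarith) _
      have hcost : 0 ≤ ∑ T ∈ large ω, s ^ T.card :=
        Finset.sum_nonneg fun T _ => pow_nonneg hs.le _
      nlinarith [mul_nonneg hcost hP0]
    have hround : colExp (fun _ => r₁) (fun ω => edgeProb r₂ (next ω)) ≤
        edgeProb (r₁ + r₂) H := by
      refine le_trans ?_ (colExp_union_le_edgeProb hH hr₁0.le hr₂0 hρ)
      refine colExp_mono (fun _ => hr₁0.le) (fun _ => by linarith) fun ω₁ => ?_
      refine colExp_mono (fun _ => hr₂0) (fun _ => by linarith) fun ω₂ => ?_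
      refine edgeInd_mono ?_
      rintro ⟨T, hT, hTω⟩
      obtain ⟨S, hS, rfl⟩ := Finset.mem_image.1 (Finset.mem_filter.1 hT).1
      obtain ⟨S', hS', -, he⟩ := hfrag.exists_eq (colGraph ω₁) S hS
      rw [he] at hTω
      exact ⟨S', hS', sdiff_le_iff.1 hTω⟩
    have hcost : colExp (fun _ => r₁) (fun ω => ∑ T ∈ large ω, s ^ T.card) ≤
        (M j ^ 2 ^ j)⁻¹ := by
      refine (colExp_cost_fragment_le hH hj hfrag hr₁0 (by linarith) hs.le ?_ (2 ^ j)).trans ?_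
      · rw [hr₁]
        nlinarith [mul_pos hs hq]
      · have hx : s * Fintype.card K / r₁ = 4⁻¹ * (M j)⁻¹ := by
          rw [hr₁]; field_simp
        -- The factor `4` in the densities absorbs the number of subsets of the picked edge.
        have hpow : (2 : ℝ) ^ (2 ^ (j + 1) - 1) ≤ 4 ^ 2 ^ j := by
          rw [show (4 : ℝ) = 2 ^ 2 by norm_num, ← pow_mul]
          exact pow_le_pow_right₀ (by norm_num) (by rw [pow_succ]; omega)
        rw [hx, mul_pow, inv_pow, inv_pow, ← mul_assoc]
        refine mul_le_of_le_one_left (by positivity) ?_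
        rw [← div_eq_mul_inv]
        exact div_le_one_of_le₀ hpow (by positivity)
    calc c * (1 - edgeProb (r₁ + r₂) H)
        ≤ c * (1 - colExp (fun _ => r₁) (fun ω => edgeProb r₂ (next ω))) := by
          gcongr
      _ = colExp (fun _ => r₁) (fun ω => c * (1 - edgeProb r₂ (next ω))) := by
          have h1 := prodExp_const (fun _ : ι => colWeight K r₁) (fun _ => sum_colWeight r₁) c
          have h2 := prodExp_add (fun _ : ι => colWeight K r₁) (fun _ => c)
            (fun ω => (-c) * edgeProb r₂ (next ω))
          rw [prodExp_const_mul, h1] at h2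
          unfold colExp
          rw [show (fun ω => c * (1 - edgeProb r₂ (next ω))) =
            fun ω => c + -c * edgeProb r₂ (next ω) from funext fun ω => by ring, h2]
          ring
      _ ≤ colExp (fun _ => r₁) (fun ω => (∑ T ∈ large ω, s ^ T.card) +
            ∑ i ∈ range j, (M i ^ 2 ^ i)⁻¹) :=
          colExp_mono (fun _ => hr₁0.le) (fun _ => by linarith) hstep
      _ = colExp (fun _ => r₁) (fun ω => ∑ T ∈ large ω, s ^ T.card) +
            ∑ i ∈ range j, (M i ^ 2 ^ i)⁻¹ := by
          unfold colExp
          rw [prodExp_add, prodExp_const _ (fun _ => sum_colWeight r₁)]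
      _ ≤ ∑ i ∈ range (j + 1), (M i ^ 2 ^ i)⁻¹ := by
          rw [Finset.sum_range_succ]
          linarith

end Fragments

/-! ### The hypergraph of rainbow colourings and the cost of its covers. -/

section RainbowHypergraph

/-- At most a proportion `1 / (q)_s` of the permutations of `q` elements take `s` prescribed
values. -/
lemma card_perm_mul_descFactorial_le {K : Type*} [Fintype K] [DecidableEq K]
    (P : Finset (K × K)) :
    (univ.filter fun σ : Equiv.Perm K => ∀ v ∈ P, σ v.1 = v.2).card *
      (Fintype.card K).descFactorial P.card ≤ (Fintype.card K).factorial := by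
  induction P using Finset.induction_on with
  | empty => simp [Fintype.card_perm]
  | insert p P hp ih =>
    refine le_trans ?_ ih
    obtain ⟨a, b⟩ := p
    rw [Finset.card_insert_of_notMem hp, Nat.descFactorial_succ, ← mul_assoc]
    refine Nat.mul_le_mul_right _ ?_
    set B := univ \ P.image Prod.snd
    have hB : Fintype.card K - P.card ≤ B.card := by
      rw [Finset.card_sdiff_of_subset (Finset.subset_univ _), Finset.card_univ]
      exact Nat.sub_le_sub_left Finset.card_image_le _
    by_cases hb : b ∈ P.image Prod.snd
    · have : (univ.filter fun σ : Equiv.Perm K => ∀ v ∈ insert (a, b) P, σ v.1 = v.2) = ∅ := by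
        rw [Finset.filter_eq_empty_iff]
        intro σ _ h
        obtain ⟨v, hv, rfl⟩ := Finset.mem_image.1 hb
        have h1 := h _ (Finset.mem_insert_self _ _)
        have h2 := h v (Finset.mem_insert_of_mem hv)
        have h3 : a = v.1 := σ.injective (h1.trans h2.symm)
        exact hp (by rw [h3]; exact hv)
      rw [this]
      simp
    -- Composing with a transposition moves the value at `a` from `b` to any colour unused by `P`.
    -- The targets are disjoint for different `b'`, which gives the factor `q - |P|`.
    have hcard : ∀ b' ∈ B,
        (univ.filter fun σ : Equiv.Perm K => ∀ v ∈ insert (a, b) P, σ v.1 = v.2).card ≤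
        ((univ.filter fun σ : Equiv.Perm K => ∀ v ∈ P, σ v.1 = v.2).filter
          fun σ => σ a = b').card := by
      intro b' hb'
      refine Finset.card_le_card_of_injOn (fun σ => Equiv.swap b b' * σ) ?_
        (fun σ _ τ _ h => mul_left_cancel h)
      intro σ hσ
      simp only [Finset.coe_filter, Finset.mem_univ, true_and, Set.mem_ofPred_eq,
        Finset.mem_filter, Equiv.Perm.mul_apply, Finset.forall_mem_insert] at hσ ⊢
      refine ⟨fun v hv => ?_, by rw [hσ.1, Equiv.swap_apply_left]⟩
      rw [hσ.2 v hv]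
      have hv2 : v.2 ∈ P.image Prod.snd := Finset.mem_image_of_mem _ hv
      exact Equiv.swap_apply_of_ne_of_ne (ne_of_mem_of_not_mem hv2 hb)
        (ne_of_mem_of_not_mem hv2 (Finset.mem_sdiff.1 hb').2)
    calc (univ.filter fun σ : Equiv.Perm K => ∀ v ∈ insert (a, b) P, σ v.1 = v.2).card *
          (Fintype.card K - P.card)
        ≤ (univ.filter fun σ : Equiv.Perm K => ∀ v ∈ insert (a, b) P, σ v.1 = v.2).card *
          B.card := Nat.mul_le_mul_left _ hB
      _ = ∑ b' ∈ B,
          (univ.filter fun σ : Equiv.Perm K => ∀ v ∈ insert (a, b) P, σ v.1 = v.2).card := by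
          rw [Finset.sum_const, smul_eq_mul, mul_comm]
      _ ≤ ∑ b' ∈ B, ((univ.filter fun σ : Equiv.Perm K => ∀ v ∈ P, σ v.1 = v.2).filter
          fun σ => σ a = b').card := Finset.sum_le_sum hcard
      _ ≤ (univ.filter fun σ : Equiv.Perm K => ∀ v ∈ P, σ v.1 = v.2).card :=
          (Finset.sum_card_fiberwise_eq_card_filter _ _ _).le.trans (Finset.card_filter_le _ _)

/-- Factor by factor, `(q - i) / q ≥ (s - i) / s`, so the ratio of `q.descFactorial s` to `q ^ s` is
at least `s! / s ^ s ≥ e ^ (-s)`. -/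
lemma pow_le_three_pow_mul_descFactorial {q s : ℕ} (h : s ≤ q) :
    (q : ℝ) ^ s ≤ 3 ^ s * q.descFactorial s := by
  rcases Nat.eq_zero_or_pos s with rfl | hs
  · simp
  have h1 : q ^ s * s.factorial ≤ s ^ s * q.descFactorial s := by
    rw [← Nat.descFactorial_self, Nat.descFactorial_eq_prod_range, Nat.descFactorial_eq_prod_range]
    have hpow : ∀ n : ℕ, n ^ s = ∏ _i ∈ range s, n := by simp
    rw [hpow q, hpow s, ← Finset.prod_mul_distrib, ← Finset.prod_mul_distrib]
    refine Finset.prod_le_prod' fun i hi => ?_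
    have hi' := Finset.mem_range.1 hi
    obtain ⟨t, rfl⟩ := Nat.exists_eq_add_of_le h
    obtain ⟨u, rfl⟩ := Nat.exists_eq_add_of_le hi'.le
    rw [show i + u - i = u by omega, show i + u + t - i = u + t by omega]
    nlinarith [Nat.zero_le (i * t)]
  have h1' : (q : ℝ) ^ s * s.factorial ≤ (s : ℝ) ^ s * q.descFactorial s := by exact_mod_cast h1
  have h2 : (s : ℝ) ^ s ≤ 3 ^ s * s.factorial := by
    have h3 := Real.pow_div_factorial_le_exp (x := (s : ℝ)) (Nat.cast_nonneg s) s
    have h4 : Real.exp s ≤ 3 ^ s := by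
      rw [← Real.exp_one_pow]
      exact pow_le_pow_left₀ (Real.exp_pos 1).le Real.exp_one_lt_three.le s
    exact (div_le_iff₀ (by positivity)).1 (h3.trans h4)
  have hf : (0 : ℝ) < s.factorial := by exact_mod_cast s.factorial_pos
  have hd : (0 : ℝ) ≤ q.descFactorial s := Nat.cast_nonneg _
  refine le_of_mul_le_mul_right ?_ hf
  calc (q : ℝ) ^ s * s.factorial ≤ (s : ℝ) ^ s * q.descFactorial s := h1'
    _ ≤ 3 ^ s * s.factorial * q.descFactorial s := mul_le_mul_of_nonneg_right h2 hd
    _ = 3 ^ s * q.descFactorial s * s.factorial := by ring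

/-- The rainbow colourings of the edges of a spread hypergraph contain a hypergraph on
`ι × K` all of whose covers are expensive. -/
lemma exists_rainbow_hypergraph {ι K : Type*} [DecidableEq ι] [Fintype K] [DecidableEq K]
    [Nonempty K] {H : Finset (Finset ι)} (hH : H.Nonempty) {r : ℕ} (hr : IsBounded H r)
    (hrK : r ≤ Fintype.card K) {κ : ℝ} (hκ : 0 < κ) (hspread : IsSpread H κ) :
    ∃ R : Finset (Finset (ι × K)), Functional R ∧ IsBounded R r ∧
      (∀ S ∈ R, S.image Prod.fst ∈ H ∧ Set.InjOn Prod.snd (S : Set (ι × K))) ∧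
      ∀ G, IsCover G R → 1 ≤ ∑ T ∈ G, (3 / (κ * Fintype.card K)) ^ T.card := by
  have hlabel : ∀ e : Finset ι, ∃ f : ι → K, e ∈ H → Set.InjOn f (e : Set ι) := by
    intro e
    by_cases he : e ∈ H
    · obtain ⟨g⟩ := Function.Embedding.nonempty_of_card_le (α := e) (β := K)
        (by rw [Fintype.card_coe]; exact (hr e he).trans hrK)
      refine ⟨fun x => if h : x ∈ e then g ⟨x, h⟩ else Classical.arbitrary K, fun _ => ?_⟩
      intro x hx y hy hxy
      rw [Finset.mem_coe] at hx hy
      simp only [hx, hy, dif_pos] at hxy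
      exact congrArg Subtype.val (g.injective hxy)
    · exact ⟨fun _ => Classical.arbitrary K, fun h => absurd h he⟩
  choose label hlabel using hlabel
  -- Indexing by permutations gives every edge the same number `q!` of copies, whatever its size.
  -- The counting below is over pairs, so coinciding copies do no harm.
  let edge : Finset ι × Equiv.Perm K → Finset (ι × K) := fun p =>
    p.1.image fun x => (x, p.2 (label p.1 x))
  have hedge : ∀ p v, v ∈ edge p ↔ v.1 ∈ p.1 ∧ p.2 (label p.1 v.1) = v.2 := by
    rintro p ⟨x, c⟩
    simp only [edge, Finset.mem_image, Prod.mk.injEq]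
    constructor
    · rintro ⟨y, hy, rfl, rfl⟩
      exact ⟨hy, rfl⟩
    · rintro ⟨hx, h⟩
      exact ⟨x, hx, rfl, h⟩
  have hfun : ∀ p, Set.InjOn Prod.fst (edge p : Set (ι × K)) := by
    intro p v hv w hw hvw
    rw [Finset.mem_coe, hedge] at hv hw
    exact Prod.ext hvw (by rw [← hv.2, ← hw.2, hvw])
  have hcard : ∀ p ∈ H ×ˢ (univ : Finset (Equiv.Perm K)), (edge p).card ≤ r := fun p hp =>
    Finset.card_image_le.trans (hr _ (Finset.mem_product.1 hp).1)
  set q := Fintype.card K with hq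
  have hq0 : (0 : ℝ) < q := by rw [hq]; exact_mod_cast Fintype.card_pos
  refine ⟨(H ×ˢ univ).image edge, ?_, ?_, ?_, ?_⟩
  · intro S hS
    obtain ⟨p, -, rfl⟩ := Finset.mem_image.1 hS
    exact hfun p
  · intro S hS
    obtain ⟨p, hp, rfl⟩ := Finset.mem_image.1 hS
    exact hcard p hp
  · intro S hS
    obtain ⟨p, hp, rfl⟩ := Finset.mem_image.1 hS
    have hpH := (Finset.mem_product.1 hp).1
    constructor
    · have : (edge p).image Prod.fst = p.1 := by
        simp [edge, Finset.image_image, Function.comp_def]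
      rwa [this]
    · intro v hv w hw hvw
      rw [Finset.mem_coe, hedge] at hv hw
      refine Prod.ext (hlabel p.1 hpH hv.1 hw.1 (p.2.injective ?_)) hvw
      rw [hv.2, hw.2, hvw]
  · intro G hG
    set N : Finset (ι × K) → Finset (Finset ι × Equiv.Perm K) := fun S =>
      (H ×ˢ univ).filter fun p => S ⊆ edge p with hN
    have hunion : (H ×ˢ (univ : Finset (Equiv.Perm K))).card ≤ ∑ S ∈ G, (N S).card := by
      refine (Finset.card_le_card ?_).trans Finset.card_biUnion_le
      intro p hp
      obtain ⟨T, hT, hTp⟩ := hG _ (Finset.mem_image_of_mem edge hp)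
      exact Finset.mem_biUnion.2 ⟨T, hT, Finset.mem_filter.2 ⟨hp, hTp⟩⟩
    have hH0 : (0 : ℝ) < H.card := by exact_mod_cast hH.card_pos
    have hf0 : (0 : ℝ) < q.factorial := by exact_mod_cast q.factorial_pos
    have hbound : ∀ S, ((N S).card : ℝ) ≤
        H.card * q.factorial * (3 / (κ * q)) ^ S.card := by
      intro S
      -- A single coloured edge containing `S` already shows that `S` has one colour per element and
      -- at most `q` pairs.
      rcases (N S).eq_empty_or_nonempty with hempty | ⟨p₀, hp₀⟩
      · rw [hempty, Finset.card_empty, Nat.cast_zero]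
        positivity
      rw [hN, Finset.mem_filter] at hp₀
      have hSfun : Set.InjOn Prod.fst (S : Set (ι × K)) :=
        (hfun p₀).mono (by exact_mod_cast hp₀.2)
      have hSq : S.card ≤ q :=
        (Finset.card_le_card hp₀.2).trans ((hcard p₀ hp₀.1).trans hrK)
      set D := S.image Prod.fst with hD
      have hDcard : D.card = S.card := Finset.card_image_of_injOn hSfun
      have hd0 : (0 : ℝ) < q.descFactorial S.card := by
        exact_mod_cast Nat.descFactorial_pos.2 hSq
      have hfib : ∀ e ∈ H.filter (fun e => D ⊆ e),
          (((N S).filter fun p => p.1 = e).card : ℝ) ≤ q.factorial / q.descFactorial S.card := by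
        intro e he
        rw [Finset.mem_filter] at he
        rw [le_div_iff₀ hd0]
        set P := S.image fun v => (label e v.1, v.2) with hP
        have hPcard : P.card = S.card := by
          refine Finset.card_image_of_injOn fun v hv w hw hvw => hSfun hv hw ?_
          exact hlabel e he.1 (he.2 (Finset.mem_image_of_mem _ hv))
            (he.2 (Finset.mem_image_of_mem _ hw)) (Prod.ext_iff.1 hvw).1
        have hle : ((N S).filter fun p => p.1 = e).card ≤
            (univ.filter fun σ : Equiv.Perm K => ∀ v ∈ P, σ v.1 = v.2).card := by
          refine Finset.card_le_card_of_injOn Prod.snd ?_ ?_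
          · intro p hp
            rw [Finset.mem_coe, Finset.mem_filter, hN, Finset.mem_filter] at hp
            obtain ⟨⟨-, hp1⟩, rfl⟩ := hp
            simp only [hP, Finset.coe_filter, Finset.mem_univ, true_and, Set.mem_ofPred_eq,
              Finset.forall_mem_image]
            exact fun v hv => ((hedge p v).1 (hp1 hv)).2
          · intro p hp p' hp' h
            exact Prod.ext (((Finset.mem_filter.1 hp).2).trans (Finset.mem_filter.1 hp').2.symm) h
        have := card_perm_mul_descFactorial_le P
        rw [hPcard, ← hq] at this
        exact_mod_cast (Nat.mul_le_mul_right _ hle).trans this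
      have hmaps : Set.MapsTo Prod.fst (N S : Set (Finset ι × Equiv.Perm K))
          (H.filter fun e => D ⊆ e : Finset (Finset ι)) := by
        intro p hp
        rw [Finset.mem_coe, hN, Finset.mem_filter, Finset.mem_product] at hp
        rw [Finset.mem_coe, Finset.mem_filter]
        refine ⟨hp.1.1, fun x hx => ?_⟩
        obtain ⟨v, hv, rfl⟩ := Finset.mem_image.1 hx
        exact ((hedge p v).1 (hp.2 hv)).1
      have hHD : ((H.filter fun e => D ⊆ e).card : ℝ) ≤ H.card / κ ^ S.card := by
        have := hspread D
        rw [hDcard] at this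
        convert this
      have hdesc : (1 : ℝ) / q.descFactorial S.card ≤ (3 / q) ^ S.card := by
        rw [div_pow, div_le_div_iff₀ hd0 (pow_pos hq0 _), one_mul]
        exact pow_le_three_pow_mul_descFactorial hSq
      calc ((N S).card : ℝ)
          = ∑ e ∈ H.filter (fun e => D ⊆ e), (((N S).filter fun p => p.1 = e).card : ℝ) := by
            rw [Finset.card_eq_sum_card_fiberwise hmaps]
            push_cast
            rfl
        _ ≤ ∑ e ∈ H.filter (fun e => D ⊆ e), (q.factorial : ℝ) / q.descFactorial S.card :=
            Finset.sum_le_sum hfib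
        _ = (H.filter fun e => D ⊆ e).card * (q.factorial * (1 / q.descFactorial S.card)) := by
            rw [Finset.sum_const, nsmul_eq_mul]
            ring
        _ ≤ (H.card / κ ^ S.card) * (q.factorial * (3 / q) ^ S.card) := by gcongr
        _ = H.card * q.factorial * (3 / (κ * q)) ^ S.card := by
            rw [div_pow, div_pow, mul_pow]
            field_simp
    have hfinal : (H.card : ℝ) * q.factorial ≤
        H.card * q.factorial * ∑ S ∈ G, (3 / (κ * q)) ^ S.card := by
      rw [Finset.mul_sum]
      refine le_trans ?_ (Finset.sum_le_sum fun S _ => hbound S)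
      rw [Finset.card_product, Finset.card_univ, Fintype.card_perm, ← hq] at hunion
      exact_mod_cast hunion
    exact (le_mul_iff_one_le_right (by positivity)).1 hfinal

end RainbowHypergraph

/-! ### Comparison of binomial and uniform random subsets. -/

section UniformSubset

variable {X : Type*} [Fintype X] [DecidableEq X]

/-- A monotone property holds for at least as large a proportion of the `m`-subsets as of the
`j`-subsets, if `j ≤ m`. -/
lemma card_filter_powersetCard_div_choose_le (P : Finset X → Prop) [DecidablePred P]
    (hP : ∀ A B, A ⊆ B → P A → P B) {j m : ℕ} (hjm : j ≤ m) (hm : m ≤ Fintype.card X) :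
    (((powersetCard j univ).filter P).card : ℝ) / (Fintype.card X).choose j ≤
      (((powersetCard m univ).filter P).card : ℝ) / (Fintype.card X).choose m := by
  induction m, hjm using Nat.le_induction with
  | base => exact le_rfl
  | succ m hjm ih =>
    refine (ih (by omega)).trans ?_
    have hcount : ((powersetCard m univ).filter P).card * (Fintype.card X - m) ≤
        ((powersetCard (m + 1) univ).filter P).card * (m + 1) := by
      -- Double counting of inclusions: each good `m`-set has `|X| - m` extensions, all good, and
      -- each `(m + 1)`-set contains `m + 1` sets of size `m`.
      refine Finset.card_mul_le_card_mul (fun A B : Finset X => A ⊆ B) ?_ ?_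
      · intro A hA
        rw [Finset.mem_filter, Finset.mem_powersetCard] at hA
        rw [← hA.1.2, ← Finset.card_compl]
        refine Finset.card_le_card_of_injOn (fun x => insert x A) ?_ ?_
        · intro x hx
          rw [Finset.mem_coe, Finset.mem_compl] at hx
          rw [Finset.mem_coe, Finset.mem_bipartiteAbove, Finset.mem_filter,
            Finset.mem_powersetCard]
          exact ⟨⟨⟨Finset.subset_univ _, by rw [Finset.card_insert_of_notMem hx, hA.1.2]⟩,
            hP _ _ (Finset.subset_insert _ _) hA.2⟩, Finset.subset_insert _ _⟩
        · intro x hx y hy hxy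
          rw [Finset.mem_coe, Finset.mem_compl] at hx
          have hmem : x ∈ insert y A := by
            have := Finset.mem_insert_self x A
            rwa [show insert x A = insert y A from hxy] at this
          exact (Finset.mem_insert.1 hmem).resolve_right hx
      · intro B hB
        rw [Finset.mem_filter, Finset.mem_powersetCard] at hB
        calc _ ≤ (powersetCard m B).card := by
              refine Finset.card_le_card fun A hA => ?_
              rw [Finset.mem_bipartiteBelow, Finset.mem_filter, Finset.mem_powersetCard] at hA
              exact Finset.mem_powersetCard.2 ⟨hA.2, hA.1.1.2⟩
          _ = m + 1 := by
              rw [Finset.card_powersetCard, hB.1.2, Nat.choose_succ_self_right]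
    have hchoose := Nat.choose_succ_right_eq (Fintype.card X) m
    have h1 : (0 : ℝ) < (Fintype.card X).choose m := by
      exact_mod_cast Nat.choose_pos (by omega)
    have h2 : (0 : ℝ) < (Fintype.card X).choose (m + 1) := by
      exact_mod_cast Nat.choose_pos hm
    rw [div_le_div_iff₀ h1 h2]
    have hnat : ((powersetCard m univ).filter P).card * (Fintype.card X).choose (m + 1) ≤
        ((powersetCard (m + 1) univ).filter P).card * (Fintype.card X).choose m := by
      refine Nat.le_of_mul_le_mul_right ?_ (by omega : 0 < m + 1)
      calc ((powersetCard m univ).filter P).card * (Fintype.card X).choose (m + 1) * (m + 1)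
          = ((powersetCard m univ).filter P).card * (Fintype.card X - m) *
              (Fintype.card X).choose m := by
            rw [mul_assoc, hchoose]; ring
        _ ≤ ((powersetCard (m + 1) univ).filter P).card * (m + 1) *
              (Fintype.card X).choose m := Nat.mul_le_mul_right _ hcount
        _ = _ := by ring
    exact_mod_cast hnat

/-- A binomial random subset has a monotone property with a probability not much larger than a
uniformly random `m`-subset. -/
lemma sum_binomial_weight_le (P : Finset X → Prop) [DecidablePred P]
    (hP : ∀ A B, A ⊆ B → P A → P B) {m : ℕ} (hm : m ≤ Fintype.card X) {ρ : ℝ} (h0 : 0 ≤ ρ)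
    (h1 : ρ ≤ 1) :
    ∑ W : Finset X, ρ ^ W.card * (1 - ρ) ^ (Fintype.card X - W.card) * (if P W then 1 else 0) ≤
      (((powersetCard m univ).filter P).card : ℝ) / (Fintype.card X).choose m +
        (1 + ρ) ^ Fintype.card X / 2 ^ m := by
  set N := Fintype.card X with hN
  have h1' : 0 ≤ 1 - ρ := by linarith
  set p := (((powersetCard m univ).filter P).card : ℝ) / N.choose m with hp
  have hp0 : 0 ≤ p := by positivity
  have hg : ∀ j ∈ range (N + 1), (((powersetCard j univ).filter P).card : ℝ) ≤
      N.choose j * (p + 2 ^ j / 2 ^ m) := by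
    intro j hj
    have hj' : j ≤ N := Nat.lt_succ_iff.1 (Finset.mem_range.1 hj)
    have hc : (0 : ℝ) < N.choose j := by exact_mod_cast Nat.choose_pos hj'
    -- Sizes up to `m` are handled by monotonicity. For larger sizes the trivial bound `1` is at
    -- most `2 ^ (j - m)`, whose average over the binomial law is the error term.
    rcases le_total j m with hjm | hmj
    · have h := card_filter_powersetCard_div_choose_le P hP hjm hm
      rw [div_le_iff₀' hc] at h
      refine h.trans (mul_le_mul_of_nonneg_left ?_ hc.le)
      exact le_add_of_nonneg_right (by positivity)
    · have h : (((powersetCard j univ).filter P).card : ℝ) ≤ N.choose j := by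
        have := Finset.card_filter_le (powersetCard j (univ : Finset X)) P
        rw [Finset.card_powersetCard, Finset.card_univ] at this
        exact_mod_cast this
      refine h.trans (le_mul_of_one_le_right hc.le ?_)
      have h2 : (1 : ℝ) ≤ 2 ^ j / 2 ^ m := by
        rw [one_le_div (by positivity)]
        exact pow_le_pow_right₀ (by norm_num) hmj
      linarith
  calc ∑ W : Finset X, ρ ^ W.card * (1 - ρ) ^ (N - W.card) * (if P W then 1 else 0)
      = ∑ j ∈ range (N + 1), ρ ^ j * (1 - ρ) ^ (N - j) *
          (((powersetCard j univ).filter P).card : ℝ) := by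
        rw [← Finset.powerset_univ, Finset.sum_powerset, Finset.card_univ, ← hN]
        refine Finset.sum_congr rfl fun j _ => ?_
        rw [Finset.card_filter]
        push_cast
        rw [Finset.mul_sum]
        refine Finset.sum_congr rfl fun W hW => ?_
        rw [(Finset.mem_powersetCard.1 hW).2]
    _ ≤ ∑ j ∈ range (N + 1), ρ ^ j * (1 - ρ) ^ (N - j) * (N.choose j * (p + 2 ^ j / 2 ^ m)) :=
        Finset.sum_le_sum fun j hj => mul_le_mul_of_nonneg_left (hg j hj) (by positivity)
    _ = p * ∑ j ∈ range (N + 1), ρ ^ j * (1 - ρ) ^ (N - j) * N.choose j +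
          (∑ j ∈ range (N + 1), (2 * ρ) ^ j * (1 - ρ) ^ (N - j) * N.choose j) / 2 ^ m := by
        rw [Finset.mul_sum, Finset.sum_div, ← Finset.sum_add_distrib]
        refine Finset.sum_congr rfl fun j _ => ?_
        rw [mul_pow]
        ring
    _ = p + (1 + ρ) ^ N / 2 ^ m := by
        rw [← add_pow, ← add_pow]
        rw [show ρ + (1 - ρ) = 1 by ring, show 2 * ρ + (1 - ρ) = 1 + ρ by ring]
        simp

end UniformSubset

/-! ### From the coloured binomial model to `rainbowProb`. -/

section Transfer

variable {X : Type*} [Fintype X] [DecidableEq X]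

/-- Absent elements carry colours too, so the law is a product of a uniform colouring of all of `X`
and a binomial subset. -/
lemma colExp_const_eq {K : Type*} [Fintype K] (ρ : ℝ) (F : (X → Bool × K) → ℝ) :
    colExp (fun _ => ρ) F = (∑ c : X → K, ∑ W : Finset X,
      ρ ^ W.card * (1 - ρ) ^ (Fintype.card X - W.card) * F fun x => (decide (x ∈ W), c x)) /
        (Fintype.card K : ℝ) ^ Fintype.card X := by
  let e : (X → K) × Finset X ≃ (X → Bool × K) :=
    { toFun := fun p x => (decide (x ∈ p.2), p.1 x)
      invFun := fun ω => (fun x => (ω x).2, univ.filter fun x => (ω x).1 = true)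
      left_inv := fun p => by simp
      right_inv := fun ω => by simp }
  rw [← Fintype.sum_prod_type', Finset.sum_div]
  refine (Fintype.sum_equiv e _ _ fun p => ?_).symm
  have : ∏ x, colWeight K ρ (e p x) = ρ ^ p.2.card * (1 - ρ) ^ (Fintype.card X - p.2.card) /
      (Fintype.card K : ℝ) ^ Fintype.card X := by
    simp only [colWeight, Finset.prod_div_distrib, e, Equiv.coe_fn_mk, decide_eq_true_eq,
      Finset.prod_ite, Finset.prod_const, Finset.card_univ]
    rw [Finset.filter_mem_eq_inter, Finset.univ_inter, Finset.filter_not,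
      Finset.filter_mem_eq_inter, Finset.univ_inter, Finset.card_sdiff_of_subset
        (Finset.subset_univ _), Finset.card_univ]
  change _ = (∏ x, colWeight K ρ (e p x)) * F (e p)
  rw [this, div_mul_eq_mul_div]
  rfl

open Classical in
lemma rainbowProb_eq (H : Finset (Finset X)) (q m : ℕ) :
    rainbowProb H q m = (∑ c : X → Fin q,
      (((powersetCard m univ).filter fun W => ContainsRainbowEdge H W c).card : ℝ) /
        (Fintype.card X).choose m) / (q : ℝ) ^ Fintype.card X := by
  -- The `Fintype` instance on colourings inside `sampleSpace` is built from classical decidable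
  -- equality.
  obtain rfl : ‹DecidableEq X› = fun a b => Classical.propDecidable (a = b) :=
    Subsingleton.elim _ _
  unfold rainbowProb sampleSpace
  rw [Finset.card_filter, Finset.sum_product_right, Finset.card_product, Finset.card_powersetCard,
    Finset.card_univ, Finset.card_univ, Fintype.card_fun, Fintype.card_fin, ← Finset.sum_div,
    div_div]
  push_cast
  congr 1
  refine Finset.sum_congr rfl fun c _ => ?_
  rw [Finset.card_filter]
  push_cast
  rfl

/-- The random coloured subset of density `ρ` contains an edge of `R` with a probability not much
larger than the coloured `m`-subset contains a rainbow edge of `H`. -/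
lemma edgeProb_le_rainbowProb_add {H : Finset (Finset X)} {q m : ℕ} (hq : 0 < q)
    {R : Finset (Finset (X × Fin q))}
    (hR : ∀ S ∈ R, S.image Prod.fst ∈ H ∧ Set.InjOn Prod.snd (S : Set (X × Fin q)))
    (hm : m ≤ Fintype.card X) {ρ : ℝ} (h0 : 0 ≤ ρ) (h1 : ρ ≤ 1) :
    edgeProb ρ R ≤ rainbowProb H q m + (1 + ρ) ^ Fintype.card X / 2 ^ m := by
  classical
  have h1' : 0 ≤ 1 - ρ := by linarith
  have hq0 : (0 : ℝ) < (q : ℝ) ^ Fintype.card X := by positivity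
  have hind : ∀ (c : X → Fin q) (W : Finset X),
      edgeInd R (colGraph fun x => (decide (x ∈ W), c x)) ≤
        if ContainsRainbowEdge H W c then 1 else 0 := by
    intro c W
    by_cases h : ∃ S ∈ R, S ⊆ colGraph fun x => (decide (x ∈ W), c x)
    · obtain ⟨S, hS, hSW⟩ := h
      have hmem : ∀ v ∈ S, v.1 ∈ W ∧ c v.1 = v.2 := fun v hv => by
        simpa [mem_colGraph] using hSW hv
      rw [if_pos]
      · exact edgeInd_le_one _ _
      · refine ⟨_, (hR S hS).1, ?_, ?_⟩
        · intro x hx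
          obtain ⟨v, hv, rfl⟩ := Finset.mem_image.1 hx
          exact (hmem v hv).1
        · intro x hx y hy hxy hc
          obtain ⟨v, hv, rfl⟩ := Finset.mem_image.1 hx
          obtain ⟨w, hw, rfl⟩ := Finset.mem_image.1 hy
          rw [(hmem v hv).2, (hmem w hw).2] at hc
          exact hxy (by rw [(hR S hS).2 hv hw hc])
    · rw [edgeInd, if_neg h]
      split_ifs <;> norm_num
  rw [edgeProb, colExp_const_eq, rainbowProb_eq, Fintype.card_fin, div_add' _ _ _ hq0.ne']
  refine div_le_div_of_nonneg_right ?_ hq0.le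
  have hconst : (1 + ρ) ^ Fintype.card X / 2 ^ m * (q : ℝ) ^ Fintype.card X =
      ∑ _c : X → Fin q, (1 + ρ) ^ Fintype.card X / 2 ^ m := by
    rw [Finset.sum_const, Finset.card_univ, Fintype.card_fun, Fintype.card_fin, nsmul_eq_mul]
    push_cast
    ring
  rw [hconst, ← Finset.sum_add_distrib]
  refine Finset.sum_le_sum fun c _ => ?_
  refine le_trans (Finset.sum_le_sum fun W _ => mul_le_mul_of_nonneg_left (hind c W)
    (by positivity)) ?_
  exact sum_binomial_weight_le (fun W => ContainsRainbowEdge H W c)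
    (fun A B hAB ⟨e, he, heA, hr⟩ => ⟨e, he, heA.trans hAB, hr⟩) hm h0 h1

end Transfer

/-! ### Choice of the round densities, the explicit bound and the limit. -/

section Main

lemma rainbowProb_le_one {X : Type*} [Fintype X] (H : Finset (Finset X)) (q m : ℕ) :
    rainbowProb H q m ≤ 1 := by
  classical
  exact div_le_one_of_le₀ (by exact_mod_cast Finset.card_filter_le _ _) (Nat.cast_nonneg _)

/-- The error term of the iteration with round densities proportional to `2 + k / 2 ^ i`. -/
lemma sum_inv_pow_two_pow_le {k : ℕ} (hk : 0 < k) :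
    ∑ i ∈ range k, (((2 : ℝ) + k / 2 ^ i) ^ 2 ^ i)⁻¹ ≤ 2 / (k : ℝ) := by
  have hk0 : (0 : ℝ) < k := by exact_mod_cast hk
  have hterm : ∀ i : ℕ, (((2 : ℝ) + k / 2 ^ i) ^ 2 ^ i)⁻¹ ≤ 2 / (k : ℝ) * (1 / 2) ^ (i + 1) := by
    intro i
    -- After a factor `2` is taken out of the base, Bernoulli supplies a gain of order `k` in every
    -- round, and `2 ^ 2 ^ i ≥ 2 ^ (i + 1)` makes the sum geometric.
    have hb : (1 : ℝ) + (2 ^ i : ℕ) * (k / (2 * 2 ^ i)) ≤ (1 + k / (2 * 2 ^ i)) ^ 2 ^ i :=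
      one_add_mul_le_pow (le_trans (by norm_num) (by positivity : (0 : ℝ) ≤ k / (2 * 2 ^ i))) _
    have he : (1 : ℝ) + (2 ^ i : ℕ) * (k / (2 * 2 ^ i)) = 1 + k / 2 := by
      push_cast
      field_simp
    rw [he] at hb
    have hpow : (2 : ℝ) ^ (i + 1) ≤ 2 ^ 2 ^ i :=
      pow_le_pow_right₀ (by norm_num) Nat.lt_two_pow_self
    have hlow : (2 : ℝ) ^ (i + 1) * (k / 2) ≤ (2 + k / 2 ^ i) ^ 2 ^ i := by
      rw [show (2 : ℝ) + k / 2 ^ i = 2 * (1 + k / (2 * 2 ^ i)) by field_simp, mul_pow]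
      exact mul_le_mul hpow (by linarith) (by positivity) (by positivity)
    calc (((2 : ℝ) + k / 2 ^ i) ^ 2 ^ i)⁻¹ ≤ ((2 : ℝ) ^ (i + 1) * (k / 2))⁻¹ :=
          inv_anti₀ (by positivity) hlow
      _ = 2 / k * (1 / 2) ^ (i + 1) := by
          rw [one_div, inv_pow, mul_inv, inv_div, mul_comm]
  have hgeom : ∀ n : ℕ, ∑ i ∈ range n, ((1 : ℝ) / 2) ^ (i + 1) = 1 - (1 / 2) ^ n := by
    intro n
    induction n with
    | zero => simp
    | succ n ih => rw [Finset.sum_range_succ, ih]; ring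
  calc ∑ i ∈ range k, (((2 : ℝ) + k / 2 ^ i) ^ 2 ^ i)⁻¹
      ≤ ∑ i ∈ range k, 2 / k * ((1 : ℝ) / 2) ^ (i + 1) := Finset.sum_le_sum fun i _ => hterm i
    _ = 2 / k * (1 - (1 / 2) ^ k) := by rw [← Finset.mul_sum, hgeom]
    _ ≤ 2 / k := mul_le_of_le_one_right (by positivity) (by
        have : (0 : ℝ) ≤ (1 / 2) ^ k := by positivity
        linarith)

/-- The last rounds, with the smallest edges, need the boost `k / 2 ^ i` to make their error vanish.
The boosts form a geometric series, so the total density stays linear in `k`. -/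
lemma sum_two_add_div_le (k : ℕ) : ∑ i ∈ range k, ((2 : ℝ) + k / 2 ^ i) ≤ 4 * k := by
  have hgeom : ∀ n : ℕ, ∑ i ∈ range n, ((1 : ℝ) / 2) ^ i = 2 - 2 * (1 / 2) ^ n := by
    intro n
    induction n with
    | zero => simp
    | succ n ih => rw [Finset.sum_range_succ, ih]; ring
  have : ∑ i ∈ range k, ((2 : ℝ) + k / 2 ^ i) = 2 * k + k * (2 - 2 * (1 / 2) ^ k) := by
    rw [← hgeom, Finset.sum_add_distrib, Finset.sum_const, Finset.card_range, nsmul_eq_mul,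
      Finset.mul_sum, mul_comm (2 : ℝ)]
    congr 1
    exact Finset.sum_congr rfl fun i _ => by rw [one_div, inv_pow, div_eq_mul_inv]
  rw [this]
  have : (0 : ℝ) ≤ k * (1 / 2) ^ k := by positivity
  linarith

/-- The spread of a hypergraph without the empty edge is at most the number of vertices. -/
lemma IsSpread.le_card {X : Type*} [Fintype X] {H : Finset (Finset X)} {κ : ℝ} (hκ : 0 < κ)
    (h : IsSpread H κ) (hH : H.Nonempty) (hempty : ∅ ∉ H) : κ ≤ Fintype.card X := by
  classical
  have hsub : H ⊆ univ.biUnion fun x : X => H.filter fun e => {x} ⊆ e := by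
    intro e he
    obtain ⟨x, hx⟩ := Finset.nonempty_iff_ne_empty.2 (ne_of_mem_of_not_mem he hempty)
    simp only [Finset.mem_biUnion, Finset.mem_filter, Finset.singleton_subset_iff]
    exact ⟨x, Finset.mem_univ x, he, hx⟩
  have hcard : (H.card : ℝ) ≤ ∑ x : X, ((H.filter fun e => {x} ⊆ e).card : ℝ) := by
    exact_mod_cast (Finset.card_le_card hsub).trans Finset.card_biUnion_le
  have hx : ∀ x : X, ((H.filter fun e => {x} ⊆ e).card : ℝ) ≤ H.card / κ := by
    intro x
    have := h {x}
    rw [Finset.card_singleton, pow_one] at this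
    convert this
  have hle := hcard.trans (Finset.sum_le_sum fun x _ => hx x)
  rw [Finset.sum_const, Finset.card_univ, nsmul_eq_mul, mul_div_assoc', le_div_iff₀ hκ] at hle
  have hH0 : (0 : ℝ) < H.card := by exact_mod_cast hH.card_pos
  nlinarith

/-- For `m ≥ 288 |X| log r / κ` the coloured `m`-subset contains a rainbow edge with probability at
least `1 - 8 / log r`. -/
theorem one_sub_le_rainbowProb {X : Type*} [Fintype X] {H : Finset (Finset X)}
    (hH : H.Nonempty) {r q m : ℕ} (hr2 : 2 ≤ r) {κ : ℝ} (hκ : 0 < κ) (hr : IsBounded H r)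
    (hspread : IsSpread H κ) (hrq : r ≤ q)
    (hm : 288 * Real.log r * Fintype.card X / κ ≤ m) (hmX : m ≤ Fintype.card X) :
    1 - 8 / Real.log r ≤ rainbowProb H q m := by
  classical
  have hlog2 := Real.log_two_gt_d9
  have hr2' : (2 : ℝ) ≤ r := by exact_mod_cast hr2
  have hlog : Real.log 2 ≤ Real.log r := Real.log_le_log (by norm_num) hr2'
  have hlog0 : 0 < Real.log r := by linarith
  have hq : 0 < q := by omega
  -- An empty edge is always rainbow and contained. It is treated apart because `κ ≤ |X|` can fail
  -- in its presence.
  by_cases hempty : ∅ ∈ H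
  · have hone : rainbowProb H q m = 1 := by
      have : Nonempty (Fin q) := ⟨⟨0, hq⟩⟩
      rw [rainbowProb_eq, div_eq_one_iff_eq (by positivity)]
      have hall : ∀ c : X → Fin q, ((powersetCard m univ).filter fun W =>
          ContainsRainbowEdge H W c) = powersetCard m univ := fun c =>
        Finset.filter_true_of_mem fun W _ => ⟨∅, hempty, by simp, by simp [IsRainbow]⟩
      have hch : ((Fintype.card X).choose m : ℝ) ≠ 0 := by
        exact_mod_cast (Nat.choose_pos hmX).ne'
      simp [hall, hch]
    rw [hone]
    have : 0 ≤ 8 / Real.log r := by positivity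
    linarith
  have hκX : κ ≤ Fintype.card X := hspread.le_card hκ hH hempty
  have hX0 : (0 : ℝ) < Fintype.card X := hκ.trans_le hκX
  have hmlog : 288 * Real.log r ≤ m := by
    refine le_trans ?_ hm
    rw [le_div_iff₀ hκ]
    exact mul_le_mul_of_nonneg_left hκX (by positivity)
  have hm0 : (0 : ℝ) < m := by linarith
  have : NeZero q := ⟨hq.ne'⟩
  obtain ⟨R, hfun, hbdd, hR, hcover⟩ := exists_rainbow_hypergraph (K := Fin q) hH hr
    (by rwa [Fintype.card_fin]) hκ hspread
  rw [Fintype.card_fin] at hcover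
  -- The `+ 1` makes `r ≤ 2 ^ k - 1`, the size bound that `k` rounds can handle.
  set k := Nat.log 2 r + 1 with hk
  have hk0 : 0 < k := Nat.succ_pos _
  have hrk : r < 2 ^ k := Nat.lt_pow_succ_log_self (by norm_num) r
  have hklog : (k : ℝ) ≤ 3 * Real.log r := by
    have h1 : (2 : ℝ) ^ Nat.log 2 r ≤ r := by
      exact_mod_cast Nat.pow_log_le_self 2 (by omega)
    have h2 := Real.log_le_log (by positivity) h1
    rw [Real.log_pow] at h2
    rw [hk]
    push_cast
    have h3 : (0 : ℝ) ≤ Nat.log 2 r := Nat.cast_nonneg _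
    nlinarith
  have hlogk : Real.log r ≤ k := by
    have h1 : (r : ℝ) ≤ 2 ^ k := by exact_mod_cast hrk.le
    have h2 := Real.log_le_log (by positivity) h1
    rw [Real.log_pow] at h2
    have h3 : (0 : ℝ) ≤ k := Nat.cast_nonneg _
    nlinarith [Real.log_two_lt_d9]
  have hq0 : (0 : ℝ) < q := by exact_mod_cast hq
  set s := 3 / (κ * q) with hs
  have hs0 : 0 < s := by positivity
  set M : ℕ → ℝ := fun i => 2 + k / 2 ^ i with hM
  have hM1 : ∀ i, 1 ≤ M i := fun i => by
    have : (0 : ℝ) ≤ k / 2 ^ i := by positivity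
    simp only [hM]
    linarith
  set ρ := 4 * s * Fintype.card (Fin q) * ∑ i ∈ range k, M i with hρ
  have hρ0 : 0 ≤ ρ := mul_nonneg (by positivity)
    (Finset.sum_nonneg fun i _ => zero_le_one.trans (hM1 i))
  -- Here `144 = 12 * 12`: one factor is `4 * 3` from the density and `s`, the other is `4 * 3` from
  -- `4 * k` and `k ≤ 3 log r`. Doubling to `288` makes the expected size at most `m / 2`.
  have hρκ : ρ ≤ 144 * Real.log r / κ := by
    have h1 : ∑ i ∈ range k, M i ≤ 12 * Real.log r := (sum_two_add_div_le k).trans (by linarith)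
    calc ρ = 12 / κ * ∑ i ∈ range k, M i := by
          rw [hρ, hs, Fintype.card_fin]
          field_simp
          ring
      _ ≤ 12 / κ * (12 * Real.log r) := mul_le_mul_of_nonneg_left h1 (by positivity)
      _ = 144 * Real.log r / κ := by ring
  have hρm : Fintype.card X * ρ ≤ m / 2 := by
    calc Fintype.card X * ρ ≤ Fintype.card X * (144 * Real.log r / κ) := by gcongr
      _ = 288 * Real.log r * Fintype.card X / κ / 2 := by ring
      _ ≤ m / 2 := by linarith
  have hρ1 : ρ ≤ 1 := by
    have hmX' : (m : ℝ) ≤ Fintype.card X := by exact_mod_cast hmX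
    by_contra hcon
    push Not at hcon
    nlinarith
  have hprob := mul_one_sub_edgeProb_le hs0 hM1 k R hfun
    (fun S hS => (hbdd S hS).trans (Nat.le_sub_one_of_lt hrk)) 1 hcover hρ1
  rw [← hρ, one_mul] at hprob
  have herr := hprob.trans (sum_inv_pow_two_pow_le hk0)
  have htransfer := edgeProb_le_rainbowProb_add hq hR hmX hρ0 hρ1
  -- What matters is a bound below `2`: the tail is then at most `(17 / 20) ^ m`, which Bernoulli
  -- bounds by `6 / m`.
  have hexp : Real.exp (1 / 2) ≤ 17 / 10 := by
    have h1 : Real.exp (1 / 2) * Real.exp (1 / 2) = Real.exp 1 := by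
      rw [← Real.exp_add]; norm_num
    nlinarith [Real.exp_one_lt_d9, Real.exp_pos (1 / 2)]
  have htail : (1 + ρ) ^ Fintype.card X / 2 ^ m ≤ 6 / m := by
    have h1 : (1 + ρ) ^ Fintype.card X ≤ (17 / 10 : ℝ) ^ m := by
      calc (1 + ρ) ^ Fintype.card X ≤ Real.exp ρ ^ Fintype.card X :=
            pow_le_pow_left₀ (by linarith) (by linarith [Real.add_one_le_exp ρ]) _
        _ = Real.exp (Fintype.card X * ρ) := (Real.exp_nat_mul _ _).symm
        _ ≤ Real.exp (m * (1 / 2)) := Real.exp_le_exp.2 (by linarith)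
        _ = Real.exp (1 / 2) ^ m := Real.exp_nat_mul _ _
        _ ≤ (17 / 10) ^ m := pow_le_pow_left₀ (Real.exp_pos _).le hexp m
    have h2 : (m : ℝ) * (3 / 17) ≤ (20 / 17) ^ m := by
      have := one_add_mul_le_pow (show (-2 : ℝ) ≤ 3 / 17 by norm_num) m
      rw [show (1 : ℝ) + 3 / 17 = 20 / 17 by norm_num] at this
      linarith
    have h3 : (2 : ℝ) ^ m = (20 / 17) ^ m * (17 / 10) ^ m := by
      rw [← mul_pow]; norm_num
    rw [div_le_div_iff₀ (by positivity) hm0, h3]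
    have h4 : (0 : ℝ) < (17 / 10) ^ m := by positivity
    nlinarith
  have h2k : 2 / (k : ℝ) ≤ 2 / Real.log r := div_le_div_of_nonneg_left (by norm_num) hlog0 hlogk
  have h6m : 6 / (m : ℝ) ≤ 6 / Real.log r :=
    div_le_div_of_nonneg_left (by norm_num) hlog0 (by linarith)
  have h8 : 8 / Real.log r = 2 / Real.log r + 6 / Real.log r := by ring
  linarith

end Main

end RainbowThreshold

theorem theorem1p2 :
    ∃ C : ℝ, 0 < C ∧ ∀ C₁ : ℝ, 0 < C₁ →
      ∀ (X : ℕ → Type*) [∀ n, Fintype (X n)]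
        (H : ∀ n, Finset (Finset (X n))) (r q m : ℕ → ℕ) (κ : ℕ → ℝ),
        (∀ n, (H n).Nonempty) →
        (∀ n, 0 < κ n) →
        (∀ n, RainbowThreshold.IsBounded (H n) (r n)) →
        (∀ n, RainbowThreshold.IsSpread (H n) (κ n)) →
        (∀ n, r n ≤ q n) →
        (∀ n, (r n : ℝ) ≤ (Fintype.card (X n) : ℝ) / 2) →
        (∀ n, (r n : ℝ) ≤ C₁ * κ n) →
        Tendsto (fun n => Real.log (Fintype.card (X n) : ℝ) / κ n) atTop (𝓝 0) →
        (∀ n, C * Real.log (r n : ℝ) * (Fintype.card (X n) : ℝ) / κ n ≤ (m n : ℝ)) →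
        (∀ n, m n ≤ Fintype.card (X n)) →
        Tendsto r atTop atTop →
        Tendsto (fun n => RainbowThreshold.rainbowProb (H n) (q n) (m n)) atTop (𝓝 1) := by
  refine ⟨288, by norm_num, ?_⟩
  intro _ _ X _ H r q m κ hH hκ hr hspread hrq _ _ _ hm hmX hrtop
  have hlog : Tendsto (fun n => Real.log (r n : ℝ)) atTop atTop :=
    Real.tendsto_log_atTop.comp (tendsto_natCast_atTop_atTop.comp hrtop)
  have hlower : Tendsto (fun n => 1 - 8 / Real.log (r n : ℝ)) atTop (𝓝 1) := by
    simpa using (hlog.const_div_atTop 8).const_sub 1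
  refine tendsto_of_tendsto_of_tendsto_of_le_of_le' hlower tendsto_const_nhds ?_
    (Eventually.of_forall fun n => RainbowThreshold.rainbowProb_le_one _ _ _)
  filter_upwards [hrtop.eventually_ge_atTop 2] with n hn
  exact RainbowThreshold.one_sub_le_rainbowProb (hH n) hn (hκ n) (hr n) (hspread n) (hrq n)
    (hm n) (hmX n)
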